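/- Let $G=(V,E)$ be a finite simple undirected graph with $n=|V|$ and $m=|E|$. A labeling of $G$ is a partition of $E$ into strong edges $S$ and weak edges $W$ (either may be empty); it is an STC-labeling if there are no two distinct strong edges $\{u,v\},\{v,w\}$ with $\{u,w\}\notin E$. An instance of Strong Triadic Closure consists of $G$ and $k\in\mathbb{N}$, and it is a yes-instance if $G$ has an STC-labeling with $|W|\le k$. The parameter is $\ell:=\max(m-k,0)$, the number of edges that have to be strong. Theorem. Strong Triadic Closure parameterized by $\ell$ admits a kernel with $O(\ell\cdot 2^{\ell})$ vertices that can be computed in $O(\sqrt{n}\,m)$ time. That is, there are a constant $C$, a function $g:\mathbb{N}\to\mathbb{N}$, and one fixed program for the unit-cost random access machine with words of $O(\log(n+m+k+2))$ bits, such that on every instance $(G,k)$, given by $n$, $m$, $k$ and a list of the edges, the program halts after at most $C\cdot(\sqrt{n}\,m+1)$ steps (the summand $1$ matters only if $m=0$) and outputs, in the same format, an instance $(G',k')$ such that 1. $(G,k)$ is a yes-instance if and only if $(G',k')$ is a yes-instance; 2. $\ell':=\max(|E(G')|-k',0)$ satisfies $\ell'\le\ell$, and $|V(G')|+|E(G')|+k'\le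 g(\ell)$; 3. $|V(G')|\le C\cdot\ell\cdot 2^{\ell}$. -/

import Mathlib

/-! Strong Triadic Closure (STC): labelings, instances, and a unit-cost word RAM. -/

/-- A labeling of `G`: a partition of the edge set into strong and weak edges
(either class may be empty). -/
structure Labeling {V : Type*} (G : SimpleGraph V) where
  strong : Set (Sym2 V)
  weak : Set (Sym2 V)
  union_eq : strong ∪ weak = G.edgeSet
  disjoint : Disjoint strong weak

/-- `L` is an STC-labeling: there are no two strong edges `{u, v}`, `{v, w}` (with `u ≠ w`, so
that the edges are distinct) for which `{u, w}` is not an edge. -/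
def Labeling.IsSTC {V : Type*} {G : SimpleGraph V} (L : Labeling G) : Prop :=
  ∀ u v w : V, u ≠ w → s(u, v) ∈ L.strong → s(v, w) ∈ L.strong → G.Adj u w

/-- An instance of Strong Triadic Closure: a finite simple graph `G` and a number `k`. -/
structure STCInstance where
  n : ℕ
  G : SimpleGraph (Fin n)
  k : ℕ

namespace STCInstance

/-- The number of edges. -/
noncomputable def m (I : STCInstance) : ℕ := I.G.edgeSet.ncard

/-- Yes-instances: some STC-labeling has at most `k` weak edges. -/
def IsYes (I : STCInstance) : Prop :=
  ∃ L : Labeling I.G, L.IsSTC ∧ L.weak.ncard ≤ I.k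

/-- The parameter `ℓ = |E| - k`, the number of edges that have to be strong. It is read as `0`
if `k > |E|`, when the instance does not ask for any strong edge. -/
noncomputable def ell (I : STCInstance) : ℕ := I.m - I.k

/-- The size of an instance. It is at least every number that occurs in the instance. -/
noncomputable def size (I : STCInstance) : ℕ := I.n + I.m + I.k

/-- `es` lists every edge of the graph exactly once, in any order, and each edge as an ordered
pair of its endpoints in one of the two orientations. -/
def IsEdgeList (I : STCInstance) (es : List (Fin I.n × Fin I.n)) : Prop :=
  (es.map fun e => s(e.1, e.2)).Nodup ∧
    ∀ e : Sym2 (Fin I.n), e ∈ es.map (fun e => s(e.1, e.2)) ↔ e ∈ I.G.edgeSet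

/-- The sequence `w` of numbers encodes the instance: `n, m, k`, followed by the endpoints
of the edges, edge by edge. -/
def Encodes (I : STCInstance) (w : List ℕ) : Prop :=
  ∃ es : List (Fin I.n × Fin I.n), I.IsEdgeList es ∧
    w = I.n :: es.length :: I.k :: es.flatMap fun e => [(e.1 : ℕ), (e.2 : ℕ)]

end STCInstance

/-! The random access machine. A program is built from the basic RAM instructions by sequencing,
branching and loops; a program mentions only finitely many registers, and the memory is
accessed indirectly, through addresses held in registers. -/

namespace RAM

/-- A comparison of two registers. -/
inductive Test where
  | lt (a b : ℕ)
  | eq (a b : ℕ)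

/-- Programs. The natural numbers `a`, `b`, `d` are names of registers. -/
inductive Prog where
  /-- No operation. -/
  | skip
  /-- `R[d] := v`, for a constant `v`. -/
  | const (d v : ℕ)
  /-- `R[d] := R[a] + R[b]`. -/
  | add (d a b : ℕ)
  /-- `R[d] := max (R[a] - R[b]) 0`. -/
  | sub (d a b : ℕ)
  /-- `R[d] := M[R[a]]`. -/
  | load (d a : ℕ)
  /-- `M[R[a]] := R[b]`. -/
  | store (a b : ℕ)
  | seq (p q : Prog)
  | ite (c : Test) (p q : Prog)
  | loop (c : Test) (p : Prog)

/-- A state of the machine: the contents of the registers and of the memory. -/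
structure State where
  reg : ℕ → ℕ
  mem : ℕ → ℕ

/-- The value of a comparison in a state. -/
def Test.Holds (s : State) : Test → Prop
  | .lt a b => s.reg a < s.reg b
  | .eq a b => s.reg a = s.reg b

/-- Write a value into a register. -/
def State.setReg (s : State) (d v : ℕ) : State :=
  { s with reg := Function.update s.reg d v }

/-- Write a value into a memory cell. -/
def State.setMem (s : State) (i v : ℕ) : State :=
  { s with mem := Function.update s.mem i v }

/-- `Exec B p s t s'`: on a machine whose words hold the numbers below `B`, the program `p`,
started in state `s`, halts in state `s'` after exactly `t` steps. Each basic instruction and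
each evaluation of a test is one step. There is no way to go on from an instruction whose
result does not fit into a word. -/
inductive Exec (B : ℕ) : Prog → State → ℕ → State → Prop where
  | skip (s : State) : Exec B .skip s 1 s
  | const (s : State) (d v : ℕ) (h : v < B) : Exec B (.const d v) s 1 (s.setReg d v)
  | add (s : State) (d a b : ℕ) (h : s.reg a + s.reg b < B) :
      Exec B (.add d a b) s 1 (s.setReg d (s.reg a + s.reg b))
  | sub (s : State) (d a b : ℕ) (h : s.reg a - s.reg b < B) :
      Exec B (.sub d a b) s 1 (s.setReg d (s.reg a - s.reg b))
  | load (s : State) (d a : ℕ) (h : s.mem (s.reg a) < B) :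
      Exec B (.load d a) s 1 (s.setReg d (s.mem (s.reg a)))
  | store (s : State) (a b : ℕ) :
      Exec B (.store a b) s 1 (s.setMem (s.reg a) (s.reg b))
  | seq {p q : Prog} {s s₁ s₂ : State} {t₁ t₂ : ℕ} (h₁ : Exec B p s t₁ s₁)
      (h₂ : Exec B q s₁ t₂ s₂) : Exec B (.seq p q) s (t₁ + t₂) s₂
  | iteTrue {c : Test} {p q : Prog} {s s₁ : State} {t : ℕ} (hc : c.Holds s)
      (h : Exec B p s t s₁) : Exec B (.ite c p q) s (t + 1) s₁
  | iteFalse {c : Test} {p q : Prog} {s s₁ : State} {t : ℕ} (hc : ¬ c.Holds s)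
      (h : Exec B q s t s₁) : Exec B (.ite c p q) s (t + 1) s₁
  | loopDone {c : Test} {p : Prog} {s : State} (hc : ¬ c.Holds s) :
      Exec B (.loop c p) s 1 s
  | loopStep {c : Test} {p : Prog} {s s₁ s₂ : State} {t₁ t₂ : ℕ} (hc : c.Holds s)
      (h₁ : Exec B p s t₁ s₁) (h₂ : Exec B (.loop c p) s₁ t₂ s₂) :
      Exec B (.loop c p) s (t₁ + t₂ + 1) s₂

/-- The initial state on input `w`: the input stands at the beginning of the memory, and
everything else is zero. -/
def init (w : List ℕ) : State where
  reg := fun _ => 0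
  mem := fun i => w.getD i 0

/-- In state `s`, the output `w` stands at the beginning of the memory. -/
def Outputs (s : State) (w : List ℕ) : Prop :=
  ∀ i < w.length, s.mem i = w.getD i 0

end RAM

/-- The program `P` is a kernelization for Strong Triadic Closure parameterized by `ℓ`, with at
most `vertexBound ℓ` vertices, in at most `timeBound I` steps on an instance `I`, on a RAM with
words of `O(log (size of I))` bits. The output is an equivalent instance, its parameter does not
exceed the given one, and its size (including the value of `k`) is bounded in terms of `ℓ`. -/
def IsSTCKernelization (P : RAM.Prog) (vertexBound : ℕ → ℕ) (timeBound : STCInstance → ℝ) :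
    Prop :=
  ∃ (c : ℕ) (g : ℕ → ℕ), ∀ (I : STCInstance) (w : List ℕ), I.Encodes w →
    ∃ (t : ℕ) (s : RAM.State) (I' : STCInstance) (w' : List ℕ),
      RAM.Exec ((I.size + 2) ^ c) P (RAM.init w) t s ∧ (t : ℝ) ≤ timeBound I ∧
      I'.Encodes w' ∧ RAM.Outputs s w' ∧
      (I.IsYes ↔ I'.IsYes) ∧
      I'.ell ≤ I.ell ∧ I'.size ≤ g I.ell ∧ I'.n ≤ vertexBound I.ell

/-! Let `l` be the number of edges that must be strong. A matching is always a strong set, so a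
graph with a matching of `l` edges is a yes-instance (`IsMatchingSet.hasStrong`). The algorithm
builds a matching greedily and stops at `l` edges. If it ends with fewer, the matched vertices cover
all edges, so an unmatched vertex has only matched neighbours, and two unmatched vertices are twins
as soon as they see the same matched vertices. The kernel keeps the matched vertices and, from every
class of unmatched twins, at most `2 * l` vertices.

Deletion is safe: `l` strong edges touch at most `2 * l` vertices. If one of these was deleted, it
has `2 * l` twins in the kernel, one of them untouched, and exchanging the two is an automorphism of
the graph (`exists_moved_edges`). The same exchange shows that at least `l` edges survive, so
choosing `k' = m' - l` preserves the parameter.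

Counting neighbourhoods in up to `2 * l` matched vertices would give only about `4 ^ l` classes. The
better bound uses a maximum matching `M`, in the analysis alone. The two ends of an edge of `M`
cannot have distinct neighbours outside `M`, since otherwise there is an augmenting path. Hence a
vertex outside `M` is determined up to twins by the set of edges of `M` that it touches, which
leaves `2 ^ |M|` classes, and `|M| < l` unless the answer is yes (`card_le_of_not_hasStrong`). So
more than `4 * l * 2 ^ l` kept vertices certify a yes-instance, and the program never has to compute
`M`.

Twin classes are recognised by masks: the matched vertices get distinct powers of two, and a vertex
gets the sum over its neighbours. If `n` is below the threshold, the input is returned; otherwise `2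
^ l ≤ n`, so masks fit into words. Every pass runs over the edges only and the arrays start as
zeros, so the time is linear in `m`. -/

namespace RAM

/-! ### Program logic for the RAM -/

/-- The weakest precondition of a loop-free program (loops are not supported). -/
def Prog.wp (B : ℕ) : Prog → (State → Prop) → State → Prop
  | .skip, Q, s => Q s
  | .const d v, Q, s => v < B ∧ Q (s.setReg d v)
  | .add d a b, Q, s => s.reg a + s.reg b < B ∧ Q (s.setReg d (s.reg a + s.reg b))
  | .sub d a b, Q, s => s.reg a - s.reg b < B ∧ Q (s.setReg d (s.reg a - s.reg b))
  | .load d a, Q, s => s.mem (s.reg a) < B ∧ Q (s.setReg d (s.mem (s.reg a)))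
  | .store a b, Q, s => Q (s.setMem (s.reg a) (s.reg b))
  | .seq p q, Q, s => p.wp B (fun s' => q.wp B Q s') s
  | .ite c p q, Q, s => (c.Holds s → p.wp B Q s) ∧ (¬ c.Holds s → q.wp B Q s)
  | .loop _ _, _, _ => False

/-- An upper bound for the running time of a loop-free program. -/
def Prog.cost : Prog → ℕ
  | .seq p q => p.cost + q.cost
  | .ite _ p q => max p.cost q.cost + 1
  | _ => 1

/-- Started in `s`, the program halts within `T` steps in a state that satisfies `Q`. -/
def Runs (B : ℕ) (P : Prog) (s : State) (T : ℕ) (Q : State → Prop) : Prop :=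
  ∃ t s', Exec B P s t s' ∧ t ≤ T ∧ Q s'

theorem Runs.mono {B : ℕ} {P : Prog} {s : State} {T T' : ℕ} {Q Q' : State → Prop}
    (h : Runs B P s T Q) (hT : T ≤ T') (hQ : ∀ s', Q s' → Q' s') : Runs B P s T' Q' := by
  obtain ⟨t, s', h1, h2, h3⟩ := h
  exact ⟨t, s', h1, h2.trans hT, hQ _ h3⟩

theorem Prog.wp.mono {B : ℕ} {P : Prog} {Q Q' : State → Prop} {s : State} (h : P.wp B Q s)
    (hQ : ∀ s', Q s' → Q' s') : P.wp B Q' s := by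
  induction P generalizing Q Q' s with
  | skip => exact hQ _ h
  | store a b => exact hQ _ h
  | seq p q ihp ihq => exact ihp h fun s' hs' => ihq hs' hQ
  | ite c p q ihp ihq => exact ⟨fun hc => ihp (h.1 hc) hQ, fun hc => ihq (h.2 hc) hQ⟩
  | loop c p => exact h
  | _ => exact ⟨h.1, hQ _ h.2⟩

theorem Prog.wp.runs {B : ℕ} {P : Prog} {Q : State → Prop} {s : State} (h : P.wp B Q s) :
    Runs B P s P.cost Q := by
  induction P generalizing Q s with
  | skip => exact ⟨1, _, .skip s, le_rfl, h⟩
  | const d v => exact ⟨1, _, .const s d v h.1, le_rfl, h.2⟩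
  | add d a b => exact ⟨1, _, .add s d a b h.1, le_rfl, h.2⟩
  | sub d a b => exact ⟨1, _, .sub s d a b h.1, le_rfl, h.2⟩
  | load d a => exact ⟨1, _, .load s d a h.1, le_rfl, h.2⟩
  | store a b => exact ⟨1, _, .store s a b, le_rfl, h⟩
  | seq p q ihp ihq =>
    obtain ⟨t₁, s₁, h1, h2, h3⟩ := ihp h
    obtain ⟨t₂, s₂, h4, h5, h6⟩ := ihq h3
    exact ⟨_, _, .seq h1 h4, Nat.add_le_add h2 h5, h6⟩
  | ite c p q ihp ihq =>
    by_cases hc : c.Holds s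
    · obtain ⟨t, s', h1, h2, h3⟩ := ihp (h.1 hc)
      exact ⟨_, _, .iteTrue hc h1, Nat.add_le_add_right (h2.trans (le_max_left _ _)) 1, h3⟩
    · obtain ⟨t, s', h1, h2, h3⟩ := ihq (h.2 hc)
      exact ⟨_, _, .iteFalse hc h1, Nat.add_le_add_right (h2.trans (le_max_right _ _)) 1, h3⟩
  | loop c p => exact h.elim

theorem Runs.seq {B : ℕ} {p q : Prog} {s : State} {T₁ T₂ : ℕ} {R Q : State → Prop}
    (hp : Runs B p s T₁ R) (hq : ∀ s', R s' → Runs B q s' T₂ Q) :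
    Runs B (.seq p q) s (T₁ + T₂) Q := by
  obtain ⟨t₁, s₁, h1, h2, h3⟩ := hp
  obtain ⟨t₂, s₂, h4, h5, h6⟩ := hq _ h3
  exact ⟨_, _, .seq h1 h4, Nat.add_le_add h2 h5, h6⟩

theorem Runs.ite {B : ℕ} {c : Test} {p q : Prog} {s : State} {T : ℕ} {Q : State → Prop}
    (hp : c.Holds s → Runs B p s T Q) (hq : ¬ c.Holds s → Runs B q s T Q) :
    Runs B (.ite c p q) s (T + 1) Q := by
  by_cases hc : c.Holds s
  · obtain ⟨t, s', h1, h2, h3⟩ := hp hc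
    exact ⟨_, _, .iteTrue hc h1, Nat.add_le_add_right h2 1, h3⟩
  · obtain ⟨t, s', h1, h2, h3⟩ := hq hc
    exact ⟨_, _, .iteFalse hc h1, Nat.add_le_add_right h2 1, h3⟩

/-- The rule for a loop whose body is executed exactly `N` times. -/
theorem Runs.loop {B : ℕ} {c : Test} {p : Prog} {s : State} (Inv : ℕ → State → Prop) (N T : ℕ)
    (h₀ : Inv 0 s)
    (hstep : ∀ i < N, ∀ s, Inv i s → c.Holds s ∧ Runs B p s T (Inv (i + 1)))
    (hend : ∀ s, Inv N s → ¬ c.Holds s) :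
    Runs B (.loop c p) s ((T + 1) * N + 1) (Inv N) := by
  suffices H : ∀ d i s, i + d = N → Inv i s → Runs B (.loop c p) s ((T + 1) * d + 1) (Inv N) from
    H N 0 s (Nat.zero_add N) h₀
  intro d
  induction d with
  | zero =>
    rintro i s rfl hi
    exact ⟨1, s, .loopDone (hend s hi), by simp, hi⟩
  | succ d ih =>
    intro i s hid hi
    obtain ⟨hc, t₁, s₁, h1, h2, h3⟩ := hstep i (by omega) s hi
    obtain ⟨t₂, s₂, h4, h5, h6⟩ := ih (i + 1) s₁ (by omega) h3
    exact ⟨_, _, .loopStep hc h1 h4, by rw [Nat.mul_succ]; omega, h6⟩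

end RAM

/-! ### Matchings, twins and the vertex bound -/

namespace STC

open Finset

variable {V W : Type*}

/-- No two edges of `S` form an induced path of `G`. -/
def IsStrongSet (G : SimpleGraph V) (S : Finset (Sym2 V)) : Prop :=
  ∀ u v w, u ≠ w → s(u, v) ∈ S → s(v, w) ∈ S → G.Adj u w

/-- Some STC-labeling of `G` has at least `l` strong edges. -/
def HasStrong (G : SimpleGraph V) (l : ℕ) : Prop :=
  ∃ S : Finset (Sym2 V), (∀ e ∈ S, e ∈ G.edgeSet) ∧ S.card = l ∧ IsStrongSet G S

/-- Strongness passes to subsets, so surplus strong edges can be made weak until exactly `ℓ` remain.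
Truncated subtraction also covers `m ≤ k`, where no strong edge is needed. -/
theorem isYes_iff_hasStrong (I : STCInstance) : I.IsYes ↔ HasStrong I.G I.ell := by
  classical
  constructor
  · rintro ⟨L, hL, hk⟩
    have hcard : L.strong.ncard + L.weak.ncard = I.m := by
      rw [STCInstance.m, ← L.union_eq, Set.ncard_union_eq L.disjoint]
    have hle : I.ell ≤ L.strong.toFinset.card := by
      rw [← Set.ncard_eq_toFinset_card', STCInstance.ell]
      omega
    obtain ⟨S, hS, hSc⟩ := exists_subset_card_eq hle
    have hmem : ∀ e ∈ S, e ∈ L.strong := fun e he => by simpa using hS he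
    refine ⟨S, fun e he => ?_, hSc, fun u v w huw h1 h2 => hL u v w huw (hmem _ h1) (hmem _ h2)⟩
    rw [← L.union_eq]
    exact Or.inl (hmem e he)
  · rintro ⟨S, hS, hSc, hst⟩
    have hsub : (S : Set (Sym2 (Fin I.n))) ⊆ I.G.edgeSet := fun e he => hS e he
    refine ⟨⟨S, I.G.edgeSet \ S, Set.union_sdiff_cancel hsub, Set.disjoint_sdiff_right⟩,
      fun u v w huw h1 h2 => hst u v w huw h1 h2, ?_⟩
    have h := Set.ncard_sdiff hsub
    simp only [Set.ncard_coe_finset, hSc] at h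
    change (I.G.edgeSet \ S).ncard ≤ _
    rw [h, STCInstance.ell, STCInstance.m]
    omega

/-- A matching of `G`, with a chosen orientation of every edge. -/
def IsMatchingSet (G : SimpleGraph V) (M : Finset (V × V)) : Prop :=
  (∀ p ∈ M, G.Adj p.1 p.2) ∧ ∀ p ∈ M, ∀ q ∈ M,
    (p.1 = q.1 ∨ p.1 = q.2 ∨ p.2 = q.1 ∨ p.2 = q.2) → p = q

/-- Distinct edges of a matching share no vertex, so the condition on paths is void. -/
theorem IsMatchingSet.hasStrong {G : SimpleGraph V} {M : Finset (V × V)}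
    (hM : IsMatchingSet G M) {l : ℕ} (hl : l ≤ M.card) : HasStrong G l := by
  classical
  obtain ⟨M', hM', rfl⟩ := exists_subset_card_eq hl
  refine ⟨M'.image fun p => s(p.1, p.2), ?_, card_image_of_injOn ?_, ?_⟩
  · simp only [mem_image]
    rintro _ ⟨p, hp, rfl⟩
    exact hM.1 p (hM' hp)
  · intro p hp q hq hpq
    refine hM.2 p (hM' hp) q (hM' hq) ?_
    rcases Sym2.eq_iff.1 hpq with h | h <;> simp [h.1]
  · intro u v w huw h1 h2
    simp only [mem_image] at h1 h2
    obtain ⟨p, hp, hpe⟩ := h1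
    obtain ⟨q, hq, hqe⟩ := h2
    have hpq : p = q := by
      refine hM.2 p (hM' hp) q (hM' hq) ?_
      rcases Sym2.eq_iff.1 hpe with h | h <;> rcases Sym2.eq_iff.1 hqe with h' | h' <;>
        simp [h.1, h.2, h'.1, h'.2]
    subst hpq
    rw [hpe] at hqe
    rcases Sym2.eq_iff.1 hqe with h | h
    · exact (huw (h.1.trans h.2)).elim
    · exact (huw h.1).elim

/-- In a maximum matching, the two ends of an edge have no distinct unmatched neighbours. -/
theorem IsMatchingSet.eq_of_maximal {G : SimpleGraph V} {M : Finset (V × V)}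
    (hM : IsMatchingSet G M) (hmax : ∀ M', IsMatchingSet G M' → M'.card ≤ M.card)
    {p : V × V} (hp : p ∈ M) {a b : V} (ha : ∀ q ∈ M, a ≠ q.1 ∧ a ≠ q.2)
    (hb : ∀ q ∈ M, b ≠ q.1 ∧ b ≠ q.2) (hpa : G.Adj p.1 a) (hpb : G.Adj p.2 b) : a = b := by
  classical
  by_contra hab
  have hadj := hM.1 p hp
  have h1 : (p.2, b) ∉ M.erase p := fun h => (hb _ (mem_of_mem_erase h)).2 rfl
  have h2 : (p.1, a) ∉ insert (p.2, b) (M.erase p) := by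
    rw [mem_insert, not_or]
    exact ⟨fun h => hadj.ne (congrArg Prod.fst h), fun h => (ha _ (mem_of_mem_erase h)).2 rfl⟩
  have hfar : ∀ q ∈ M.erase p, p.1 ≠ q.1 ∧ p.1 ≠ q.2 ∧ p.2 ≠ q.1 ∧ p.2 ≠ q.2 := by
    intro q hq
    have := hM.2 p hp q (mem_of_mem_erase hq)
    have hne := (ne_of_mem_erase hq).symm
    tauto
  -- Otherwise `a, p.1, p.2, b` is an augmenting path: trading `p` for its two outer edges enlarges
  -- the matching.
  have hcard := hmax (insert (p.1, a) (insert (p.2, b) (M.erase p))) ?_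
  · rw [card_insert_of_notMem h2, card_insert_of_notMem h1, card_erase_of_mem hp] at hcard
    have := card_pos.2 ⟨p, hp⟩
    omega
  · have hap := ha p hp
    have hbp := hb p hp
    constructor
    · simp only [mem_insert]
      rintro q (rfl | rfl | hq)
      exacts [hpa, hpb, hM.1 q (mem_of_mem_erase hq)]
    · simp only [mem_insert]
      rintro q (rfl | rfl | hq) q' (rfl | rfl | hq') h
      · rfl
      · simp only at h
        have := hadj.ne
        tauto
      · have h3 := hfar q' hq'
        have h4 := ha q' (mem_of_mem_erase hq')
        simp only at h
        tauto
      · have := hadj.ne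
        have h5 := Ne.symm hap.1
        have h6 := Ne.symm hap.2
        have h7 := Ne.symm hbp.1
        have h8 := Ne.symm hab
        have h9 := Ne.symm this
        simp only at h
        tauto
      · rfl
      · have h3 := hfar q' hq'
        have h4 := hb q' (mem_of_mem_erase hq')
        simp only at h
        tauto
      · have h3 := hfar q hq
        have h4 := ha q (mem_of_mem_erase hq)
        simp only [eq_comm (a := q.1), eq_comm (a := q.2)] at h
        tauto
      · have h3 := hfar q hq
        have h4 := hb q (mem_of_mem_erase hq)
        simp only [eq_comm (a := q.1), eq_comm (a := q.2)] at h
        tauto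
      · exact hM.2 q (mem_of_mem_erase hq) q' (mem_of_mem_erase hq') h

/-- If no labeling has `l` strong edges, then a set of vertices that contains few vertices of every
class of twins, apart from those in a small set `X`, is small. -/
theorem card_le_of_not_hasStrong [Fintype V] {G : SimpleGraph V} {l : ℕ}
    (hno : ¬ HasStrong G l) {K X : Finset V} (hX : X.card ≤ 2 * l)
    (hK : ∀ D ⊆ K, (∀ v ∈ D, v ∉ X) → (∀ v ∈ D, ∀ w ∈ D, ∀ x, G.Adj v x → G.Adj w x) → D.card ≤ 2 * l) :
    K.card ≤ 4 * l * 2 ^ l := by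
  classical
  obtain ⟨M, hM, hmax⟩ : ∃ M : Finset (V × V), IsMatchingSet G M ∧
      ∀ M', IsMatchingSet G M' → M'.card ≤ M.card := by
    obtain ⟨M, h1, h2⟩ := exists_max_image (univ.filter (IsMatchingSet G)) card
      ⟨∅, by simp [IsMatchingSet]⟩
    exact ⟨M, by simpa using h1, fun M' h => h2 M' (by simpa using h)⟩
  have hlt : M.card < l := by
    by_contra h
    exact hno (hM.hasStrong (not_lt.1 h))
  set U : Finset V := M.image Prod.fst ∪ M.image Prod.snd with hU
  have hUc : U.card ≤ 2 * M.card := by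
    refine (card_union_le _ _).trans ?_
    have h1 := card_image_le (s := M) (f := Prod.fst)
    have h2 := card_image_le (s := M) (f := Prod.snd)
    omega
  have hfree : ∀ v, v ∉ U → ∀ q ∈ M, v ≠ q.1 ∧ v ≠ q.2 := by
    intro v hv q hq
    constructor <;> rintro rfl <;> apply hv
    · exact mem_union_left _ (mem_image_of_mem _ hq)
    · exact mem_union_right _ (mem_image_of_mem _ hq)
  have hind : ∀ v x, v ∉ U → x ∉ U → ¬ G.Adj v x := by
    intro v x hv hx hvx
    have h1 := hfree v hv
    have h2 := hfree x hx
    have hn : (v, x) ∉ M := fun h => (h1 _ h).1 rfl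
    have := hmax (insert (v, x) M) ?_
    · rw [card_insert_of_notMem hn] at this
      omega
    · constructor
      · simp only [mem_insert]
        rintro q (rfl | hq)
        exacts [hvx, hM.1 q hq]
      · simp only [mem_insert]
        rintro q (rfl | hq) q' (rfl | hq') h
        · rfl
        · have h3 := h1 q' hq'
          have h4 := h2 q' hq'
          simp only at h
          tauto
        · have h3 := h1 q hq
          have h4 := h2 q hq
          simp only [eq_comm (a := q.1), eq_comm (a := q.2)] at h
          tauto
        · exact hM.2 q hq q' hq' h
  -- The trace forgets which end of a matching edge is seen; this is what gives `2 ^ |M|` classes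
  -- instead of `4 ^ |M|`.
  set tr : V → Finset (V × V) := fun v => M.filter fun p => G.Adj p.1 v ∨ G.Adj p.2 v with htr
  have htwin : ∀ v w, v ∉ U → w ∉ U → tr v = tr w → ∀ x, G.Adj v x → G.Adj w x := by
    intro v w hv hw hvw x hvx
    have hxU : x ∈ U := by
      by_contra hx
      exact hind v x hv hx hvx
    rcases mem_union.1 hxU with hx | hx <;> obtain ⟨p, hp, rfl⟩ := mem_image.1 hx
    · have hpw : p ∈ tr w := hvw ▸ mem_filter.2 ⟨hp, Or.inl hvx.symm⟩
      rcases (mem_filter.1 hpw).2 with h | h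
      · exact h.symm
      -- Here `v` and `w` see different ends of `p`, and maximality forces `v = w`.
      · have := hM.eq_of_maximal hmax hp (hfree v hv) (hfree w hw) hvx.symm h
        exact this ▸ hvx
    · have hpw : p ∈ tr w := hvw ▸ mem_filter.2 ⟨hp, Or.inr hvx.symm⟩
      rcases (mem_filter.1 hpw).2 with h | h
      · have := hM.eq_of_maximal hmax hp (hfree w hw) (hfree v hv) h hvx.symm
        exact this.symm ▸ hvx
      · exact h.symm
  have hrest : ((K \ X) \ U).card ≤ 2 * l * M.powerset.card := by
    refine card_le_mul_card_image_of_maps_to (f := tr) (fun v _ => ?_) _ fun τ _ => ?_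
    · exact mem_powerset.2 (filter_subset _ _)
    · refine hK _ (fun v hv => ?_) (fun v hv => ?_) ?_
      · exact (mem_sdiff.1 (mem_sdiff.1 (mem_filter.1 hv).1).1).1
      · exact (mem_sdiff.1 (mem_sdiff.1 (mem_filter.1 hv).1).1).2
      intro v hv w hw
      simp only [mem_filter, mem_sdiff] at hv hw
      exact htwin v w hv.1.2 hw.1.2 (hv.2.trans hw.2.symm)
  rw [card_powerset] at hrest
  have hsplit : K.card ≤ ((K \ X) \ U).card + U.card + X.card := by
    have h1 := card_le_card_sdiff_add_card (s := K \ X) (t := U)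
    have h2 := card_le_card_sdiff_add_card (s := K) (t := X)
    omega
  -- With `|M| ≤ d = l - 1` the three pieces have at most `2 * l * 2 ^ d`, `2 * d` and `2 * l`
  -- elements.
  obtain ⟨d, rfl⟩ : ∃ d, l = d + 1 := ⟨l - 1, by omega⟩
  have hpow : 2 ^ M.card ≤ 2 ^ d := Nat.pow_le_pow_right (by norm_num) (by omega)
  have hone : 1 ≤ 2 ^ d := Nat.one_le_two_pow
  rw [pow_succ]
  nlinarith

/-! ### Exchanging twins, and safety of the deletion -/

/-- A set of at most `l` edges can be moved into `K`, if every vertex outside of `K`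
has sufficiently many twins in `K`. -/
theorem exists_moved_edges {G : SimpleGraph V} {l : ℕ} {K : Set V}
    (hK : ∀ v ∉ K, ∀ x, G.Adj v x → ∃ D : Finset V, 2 * l ≤ D.card ∧
      ∀ w ∈ D, w ∈ K ∧ ∀ y, G.Adj w y ↔ G.Adj v y)
    (S : Finset (Sym2 V)) (hS : ∀ e ∈ S, e ∈ G.edgeSet) (hSl : S.card = l) :
    ∃ S' : Finset (Sym2 V), (∀ e ∈ S', e ∈ G.edgeSet ∧ ∀ x ∈ e, x ∈ K) ∧ S'.card = l ∧
      (IsStrongSet G S → IsStrongSet G S') := by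
  classical
  -- Induction on the number of touched vertices outside `K`.
  have key : ∀ d : ℕ, ∀ S : Finset (Sym2 V), (∀ e ∈ S, e ∈ G.edgeSet) → S.card = l →
      ((S.biUnion Sym2.toFinset).filter (· ∉ K)).card = d →
      ∃ S' : Finset (Sym2 V), (∀ e ∈ S', e ∈ G.edgeSet ∧ ∀ x ∈ e, x ∈ K) ∧ S'.card = l ∧
        (IsStrongSet G S → IsStrongSet G S') := by
    intro d
    induction d with
    | zero =>
      intro S hS hSl hd
      refine ⟨S, fun e he => ⟨hS e he, fun x hx => ?_⟩, hSl, id⟩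
      by_contra hxK
      rw [card_eq_zero] at hd
      have : x ∈ (∅ : Finset V) := hd ▸ mem_filter.2 ⟨mem_biUnion.2 ⟨e, he, by simpa⟩, hxK⟩
      simp at this
    | succ d ih =>
      intro S hS hSl hd
      obtain ⟨v, hv⟩ := card_pos.1 (by omega : 0 < ((S.biUnion Sym2.toFinset).filter (· ∉ K)).card)
      obtain ⟨hvS, hvK⟩ := mem_filter.1 hv
      obtain ⟨e, he, hve⟩ := mem_biUnion.1 hvS
      rw [Sym2.mem_toFinset] at hve
      obtain ⟨x, rfl⟩ := hve
      obtain ⟨D, hDc, hD⟩ := hK v hvK x (hS _ he)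
      have htc : (S.biUnion Sym2.toFinset).card ≤ 2 * l := by
        rw [← hSl, mul_comm]
        refine card_biUnion_le_card_mul _ _ _ fun e _ => ?_
        induction e with
        | h a b =>
          rw [Sym2.toFinset_mk_eq]
          exact card_le_two
      -- `S` touches at most `2 * l` vertices and one of them is `v ∉ D`, so it misses a vertex of
      -- `D`.
      obtain ⟨w, hwD, hwS⟩ : ∃ w ∈ D, w ∉ S.biUnion Sym2.toFinset := by
        by_contra hcon
        push Not at hcon
        have hsub : insert v D ⊆ S.biUnion Sym2.toFinset := by
          intro z hz
          rcases mem_insert.1 hz with rfl | hz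
          exacts [hvS, hcon z hz]
        have := card_le_card hsub
        rw [card_insert_of_notMem fun h => hvK (hD v h).1] at this
        omega
      obtain ⟨hwK, htw⟩ := hD w hwD
      have hvw : v ≠ w := fun h => hvK (h ▸ hwK)
      -- The twins `v` and `w` are not adjacent, since this would give a loop at `v`. Hence the
      -- transposition is an automorphism.
      set σ : Equiv.Perm V := Equiv.swap v w with hσ
      have hσadj : ∀ a b, G.Adj a b → G.Adj (σ a) (σ b) := by
        have hn : ¬ G.Adj w v := fun h => G.loopless.irrefl v ((htw v).1 h)
        intro a b hab
        rw [hσ, Equiv.swap_apply_def, Equiv.swap_apply_def]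
        have htw' : ∀ y, G.Adj y w ↔ G.Adj y v := fun y => by
          rw [G.adj_comm, htw, G.adj_comm]
        split_ifs with h1 h2 h3 h4 h5 h6 h7 h8
        all_goals simp only [*, G.irrefl] at hab ⊢
        all_goals exact hab
      have hmem : ∀ a b, s(a, b) ∈ S.image (Sym2.map σ) → s(σ a, σ b) ∈ S := by
        intro a b hab
        obtain ⟨e, he, hee⟩ := mem_image.1 hab
        have := congrArg (Sym2.map σ) hee
        rw [Sym2.map_map] at this
        have hid : (σ ∘ σ : V → V) = id := by
          funext z
          simp [hσ]
        rw [hid, Sym2.map_id, id, Sym2.map_mk] at this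
        exact this ▸ he
      have hS1 : ∀ e ∈ S.image (Sym2.map σ), e ∈ G.edgeSet := by
        intro e he
        obtain ⟨e, he', rfl⟩ := mem_image.1 he
        have := hS e he'
        induction e with
        | h a b => exact hσadj a b this
      have hS2 : (S.image (Sym2.map σ)).card = l := by
        rw [card_image_of_injective _ (Sym2.map.injective σ.injective), hSl]
      have hS3 : (((S.image (Sym2.map σ)).biUnion Sym2.toFinset).filter (· ∉ K)).card = d := by
        have : (((S.image (Sym2.map σ)).biUnion Sym2.toFinset).filter (· ∉ K)) =
            ((S.biUnion Sym2.toFinset).filter (· ∉ K)).erase v := by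
          ext z
          have hz : z ∈ (S.image (Sym2.map σ)).biUnion Sym2.toFinset ↔
              σ z ∈ S.biUnion Sym2.toFinset := by
            simp only [mem_biUnion, mem_image, Sym2.mem_toFinset]
            constructor
            · rintro ⟨_, ⟨e, he, rfl⟩, hz⟩
              obtain ⟨y, hy, rfl⟩ := Sym2.mem_map.1 hz
              exact ⟨e, he, by simpa [hσ] using hy⟩
            · rintro ⟨e, he, hz⟩
              exact ⟨_, ⟨e, he, rfl⟩, Sym2.mem_map.2 ⟨_, hz, by simp [hσ]⟩⟩
          rw [mem_filter, mem_erase, mem_filter, hz]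
          by_cases hzv : z = v
          · subst hzv
            simp only [hσ, Equiv.swap_apply_left, ne_eq, not_true_eq_false, false_and, iff_false]
            exact fun h => hwS h.1
          · by_cases hzw : z = w
            · subst hzw
              simp [hwK]
            · rw [hσ, Equiv.swap_apply_of_ne_of_ne hzv hzw]
              simp [hzv]
        rw [this, card_erase_of_mem hv, hd, Nat.add_sub_cancel]
      obtain ⟨S', h1, h2, h3⟩ := ih _ hS1 hS2 hS3
      refine ⟨S', h1, h2, fun hst => h3 fun a b c hac hab hbc => ?_⟩
      have := hσadj _ _ (hst (σ a) (σ b) (σ c) (σ.injective.ne hac) (hmem _ _ hab) (hmem _ _ hbc))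
      simpa [hσ] using this
  exact key _ S hS hSl rfl

/-- Transfer of a set of edges to an induced subgraph. -/
theorem exists_edges_comap {G : SimpleGraph V} (φ : W ↪ V) (S : Finset (Sym2 V))
    (hS : ∀ e ∈ S, e ∈ G.edgeSet ∧ ∀ x ∈ e, x ∈ Set.range φ) :
    ∃ S' : Finset (Sym2 W), (∀ e ∈ S', e ∈ (G.comap φ).edgeSet) ∧ S'.card = S.card ∧
      (IsStrongSet G S → IsStrongSet (G.comap φ) S') := by
  classical
  have hinj : Function.Injective (Sym2.map φ) := Sym2.map.injective φ.injective
  refine ⟨S.preimage (Sym2.map φ) hinj.injOn, ?_, ?_, ?_⟩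
  · intro e he
    have := (hS _ (mem_preimage.1 he)).1
    induction e with
    | h a b => exact this
  · rw [card_preimage, filter_true_of_mem]
    intro e he
    have h := (hS e he).2
    induction e with
    | h a b =>
      obtain ⟨a', rfl⟩ := h a (by simp)
      obtain ⟨b', rfl⟩ := h b (by simp)
      exact ⟨s(a', b'), rfl⟩
  · intro hst u v w huw h1 h2
    exact hst (φ u) (φ v) (φ w) (φ.injective.ne huw) (mem_preimage.1 h1 :) (mem_preimage.1 h2 :)

/-- Deleting vertices that have many twins does not change the answer, and it leaves at least
`l` edges. -/
theorem hasStrong_comap_iff {G : SimpleGraph V} {l : ℕ} (φ : W ↪ V)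
    (hK : ∀ v ∉ Set.range φ, ∀ x, G.Adj v x → ∃ D : Finset V, 2 * l ≤ D.card ∧
      ∀ w ∈ D, w ∈ Set.range φ ∧ ∀ y, G.Adj w y ↔ G.Adj v y) :
    HasStrong G l ↔ HasStrong (G.comap φ) l := by
  classical
  constructor
  · rintro ⟨S, h1, h2, h3⟩
    obtain ⟨S', h4, h5, h6⟩ := exists_moved_edges hK S h1 h2
    obtain ⟨S'', h7, h8, h9⟩ := exists_edges_comap φ S' h4
    exact ⟨S'', h7, h8.trans h5, h9 (h6 h3)⟩
  · rintro ⟨S, h1, h2, h3⟩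
    refine ⟨S.image (Sym2.map φ), ?_, ?_, ?_⟩
    · intro e he
      obtain ⟨e, he', rfl⟩ := mem_image.1 he
      have := h1 e he'
      induction e with
      | h a b => exact this
    · rw [card_image_of_injective _ (Sym2.map.injective φ.injective), h2]
    · intro u v w huw hu hw
      obtain ⟨e, he, hee⟩ := mem_image.1 hu
      obtain ⟨f, hf, hfe⟩ := mem_image.1 hw
      have hmem : ∀ {e : Sym2 W} {a b : V}, Sym2.map φ e = s(a, b) →
          ∃ a' b', φ a' = a ∧ φ b' = b ∧ e = s(a', b') := by
        intro e a b h
        induction e with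
        | h c d =>
          rcases Sym2.eq_iff.1 h with h | h
          · exact ⟨c, d, h.1, h.2, rfl⟩
          · exact ⟨d, c, h.2, h.1, Sym2.eq_swap⟩
      obtain ⟨u, v, rfl, rfl, rfl⟩ := hmem hee
      obtain ⟨v', w, hv, rfl, rfl⟩ := hmem hfe
      obtain rfl := φ.injective hv
      exact h3 u v' w (fun h => huw (congrArg φ h)) he hf

/-- The exchange argument applied to any `l` edges, strong or not. It ensures that the new `k`,
computed as the number of kept edges minus `l`, is not truncated. -/
theorem le_ncard_edgeSet_comap [Finite W] {G : SimpleGraph V} {l : ℕ} (φ : W ↪ V)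
    (hK : ∀ v ∉ Set.range φ, ∀ x, G.Adj v x → ∃ D : Finset V, 2 * l ≤ D.card ∧
      ∀ w ∈ D, w ∈ Set.range φ ∧ ∀ y, G.Adj w y ↔ G.Adj v y)
    (hl : l ≤ G.edgeSet.ncard) : l ≤ (G.comap φ).edgeSet.ncard := by
  classical
  obtain ⟨E, hE, hEl⟩ := Set.exists_subset_card_eq hl
  rcases Nat.eq_zero_or_pos l with rfl | hpos
  · exact Nat.zero_le _
  have hfin : E.Finite := Set.finite_of_ncard_pos (by omega)
  obtain ⟨S', h4, h5, -⟩ := exists_moved_edges hK hfin.toFinset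
    (fun e he => hE (hfin.mem_toFinset.1 he)) (by rw [← Set.ncard_eq_toFinset_card E hfin, hEl])
  obtain ⟨S'', h7, h8, -⟩ := exists_edges_comap φ S' h4
  rw [← h5, ← h8, ← Set.ncard_coe_finset]
  exact Set.ncard_le_ncard (fun e he => h7 e he) (Set.toFinite _)

end STC

/-! ### Invariants of the greedy matching, the masks and the selection -/

namespace STC

open Finset Function

variable {n m l : ℕ}

/-- The edges of `G` are, each of them once, the pairs `a j`, `b j` with `j < m`. -/
structure EdgeSeq (G : SimpleGraph (Fin n)) (m : ℕ) (a b : ℕ → Fin n) : Prop where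
  adj_iff : ∀ u v, G.Adj u v ↔ ∃ j < m, s(a j, b j) = s(u, v)
  inj : ∀ i < m, ∀ j < m, s(a i, b i) = s(a j, b j) → i = j

theorem EdgeSeq.adj {G : SimpleGraph (Fin n)} {a b : ℕ → Fin n} (h : EdgeSeq G m a b) {j : ℕ}
    (hj : j < m) : G.Adj (a j) (b j) :=
  (h.adj_iff _ _).2 ⟨j, hj, rfl⟩

/-- The vertices with `f v ≠ 0` are numbered by `1, …, r`. -/
structure Numbering (f : Fin n → ℕ) (r : ℕ) : Prop where
  le : ∀ u, f u ≤ r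
  inj : ∀ u v, f u ≠ 0 → f u = f v → u = v
  surj : ∀ t < r, ∃ u, f u = t + 1

theorem Numbering.zero : Numbering (fun _ : Fin n => 0) 0 :=
  ⟨fun _ => le_rfl, fun _ _ h => (h rfl).elim, fun t ht => (Nat.not_lt_zero t ht).elim⟩

theorem Numbering.update {f : Fin n → ℕ} {r : ℕ} (h : Numbering f r) {u : Fin n} (hu : f u = 0) :
    Numbering (update f u (r + 1)) (r + 1) := by
  refine ⟨fun v => ?_, fun v w hv hvw => ?_, fun t ht => ?_⟩
  · have := h.le v
    rw [update_apply]
    split_ifs <;> omega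
  · have h1 := h.le v
    have h2 := h.le w
    rw [update_apply, update_apply] at hvw
    rw [update_apply] at hv
    split_ifs at hv hvw with h3 h4 h5
    · rw [h3, h4]
    · omega
    · omega
    · exact h.inj v w hv hvw
  · rcases Nat.lt_succ_iff_lt_or_eq.1 ht with ht | rfl
    · obtain ⟨v, hv⟩ := h.surj t ht
      have hvu : v ≠ u := by
        rintro rfl
        omega
      exact ⟨v, by rw [update_of_ne hvu, hv]⟩
    · exact ⟨u, update_self ..⟩

theorem Numbering.exists_embedding {f : Fin n → ℕ} {r : ℕ} (h : Numbering f r) :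
    ∃ φ : Fin r ↪ Fin n, (∀ t, f (φ t) = t + 1) ∧ ∀ v, v ∈ Set.range φ ↔ f v ≠ 0 := by
  choose g hg using fun t : Fin r => h.surj t t.2
  have hinj : Injective g := fun s t hst => by
    have h1 := hg s
    have h2 := hg t
    rw [hst] at h1
    exact Fin.ext (by omega)
  refine ⟨⟨g, hinj⟩, hg, fun v => ⟨?_, fun hv => ?_⟩⟩
  · rintro ⟨t, rfl⟩
    exact (hg t).symm ▸ Nat.succ_ne_zero _
  · have h1 := h.le v
    have h2 := hg ⟨f v - 1, by omega⟩
    simp only at h2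
    exact ⟨⟨f v - 1, by omega⟩, (h.inj v (g _) hv (by omega)).symm⟩

theorem Numbering.le_card {f : Fin n → ℕ} {r : ℕ} (h : Numbering f r) : r ≤ n := by
  obtain ⟨φ, -, -⟩ := h.exists_embedding
  simpa using Fintype.card_le_of_embedding φ

theorem Numbering.card_filter {f : Fin n → ℕ} {r : ℕ} (h : Numbering f r) :
    (univ.filter fun v => f v ≠ 0).card = r := by
  obtain ⟨φ, -, h2⟩ := h.exists_embedding
  have : (univ.filter fun v => f v ≠ 0) = univ.map φ := by
    ext v
    simp [← h2]
  rw [this, card_map, card_fin]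

/-- The state of the greedy matching after the first `i` edges: `f` numbers the `r` matched
vertices, and the search stops when `l` edges are found. -/
structure MatchInv (G : SimpleGraph (Fin n)) (l : ℕ) (a b : ℕ → Fin n) (i : ℕ) (f : Fin n → ℕ)
    (r : ℕ) : Prop where
  num : Numbering f r
  le : r ≤ 2 * l
  cover : ∀ j < i, f (a j) ≠ 0 ∨ f (b j) ≠ 0 ∨ r = 2 * l
  matching : ∃ M : Finset (Fin n × Fin n), IsMatchingSet G M ∧ 2 * M.card = r ∧
    ∀ p ∈ M, f p.1 ≠ 0 ∧ f p.2 ≠ 0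

section

variable {G : SimpleGraph (Fin n)} {a b : ℕ → Fin n} {f : Fin n → ℕ} {r i : ℕ}

theorem MatchInv.zero : MatchInv G l a b 0 (fun _ => 0) 0 :=
  ⟨.zero, Nat.zero_le _, fun j hj => (Nat.not_lt_zero j hj).elim,
    ∅, by simp [IsMatchingSet], by simp, by simp⟩

theorem MatchInv.skip (h : MatchInv G l a b i f r)
    (hi : f (a i) ≠ 0 ∨ f (b i) ≠ 0 ∨ r = 2 * l) : MatchInv G l a b (i + 1) f r := by
  refine ⟨h.num, h.le, fun j hj => ?_, h.matching⟩
  rcases Nat.lt_succ_iff_lt_or_eq.1 hj with hj | rfl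
  exacts [h.cover j hj, hi]

theorem MatchInv.match (h : MatchInv G l a b i f r) (hG : G.Adj (a i) (b i))
    (ha : f (a i) = 0) (hb : f (b i) = 0) (hr : r < 2 * l) :
    MatchInv G l a b (i + 1) (update (update f (a i) (r + 1)) (b i) (r + 1 + 1)) (r + 1 + 1) := by
  have hb' : update f (a i) (r + 1) (b i) = 0 := by rw [update_of_ne hG.ne', hb]
  have hmono : ∀ v, f v ≠ 0 → update (update f (a i) (r + 1)) (b i) (r + 1 + 1) v ≠ 0 := by
    intro v hv
    rw [update_apply, update_apply]
    split_ifs <;> omega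
  obtain ⟨M, hM, hMc, hMf⟩ := h.matching
  -- `r` is twice the size of a matching, hence even, so `r < 2 * l` leaves room for two more
  -- vertices.
  refine ⟨(h.num.update ha).update hb', by omega, fun j hj => ?_,
    insert (a i, b i) M, ⟨?_, ?_⟩, ?_, ?_⟩
  · rcases Nat.lt_succ_iff_lt_or_eq.1 hj with hj | rfl
    · rcases h.cover j hj with h | h | h
      · exact Or.inl (hmono _ h)
      · exact Or.inr (Or.inl (hmono _ h))
      · omega
    · exact Or.inr (Or.inl (by simp))
  · simp only [mem_insert]
    rintro p (rfl | hp)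
    exacts [hG, hM.1 p hp]
  · have hne : ∀ p ∈ M, a i ≠ p.1 ∧ a i ≠ p.2 ∧ b i ≠ p.1 ∧ b i ≠ p.2 := by
      intro p hp
      have h1 := (hMf p hp).1
      have h2 := (hMf p hp).2
      refine ⟨?_, ?_, ?_, ?_⟩ <;> intro h <;> simp_all
    simp only [mem_insert]
    rintro p (rfl | hp) q (rfl | hq) hpq
    · rfl
    · have := hne q hq
      tauto
    · have := hne p hp
      simp only [eq_comm (a := p.1), eq_comm (a := p.2)] at hpq
      tauto
    · exact hM.2 p hp q hq hpq
  · rw [card_insert_of_notMem fun h => (hMf _ h).1 ha]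
    omega
  · simp only [mem_insert]
    rintro p (rfl | hp)
    · refine ⟨?_, by simp⟩
      rw [update_of_ne hG.ne]
      simp
    · exact ⟨hmono _ (hMf p hp).1, hmono _ (hMf p hp).2⟩

theorem MatchInv.hasStrong (h : MatchInv G l a b i f r) (hr : ¬ r < 2 * l) : HasStrong G l := by
  obtain ⟨M, hM, hMc, -⟩ := h.matching
  exact hM.hasStrong (by omega)

/-- The matched vertices have distinct powers of two as weights, the others have weight `0`. -/
def weight (f : Fin n → ℕ) (u : Fin n) : ℕ := if f u = 0 then 0 else 2 ^ (f u - 1)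

theorem weight_zero : weight (fun _ : Fin n => 0) = fun _ => 0 := by
  funext u
  simp [weight]

theorem weight_update (u : Fin n) :
    weight (update f u (r + 1)) = update (weight f) u (2 ^ r) := by
  funext v
  rcases eq_or_ne v u with rfl | h
  · simp [weight]
  · simp [weight, h]

/-- Matched vertices have distinct numbers, so the sum is the binary code of the matched part of
`s`. -/
theorem sum_weight (s : Finset (Fin n)) (h : Numbering f r) :
    ∑ x ∈ s, weight f x =
      ∑ t ∈ (s.filter fun x => f x ≠ 0).image fun x => f x - 1, 2 ^ t := by
  rw [sum_image, sum_filter]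
  · exact sum_congr rfl fun x _ => by simp [weight]
  · intro x hx y hy hxy
    simp only [coe_filter, Set.mem_ofPred_eq] at hx hy
    exact h.inj x y hx.2 (by simp only at hxy; omega)

theorem sum_weight_lt (s : Finset (Fin n)) (h : Numbering f r) :
    ∑ x ∈ s, weight f x < 2 ^ r := by
  rw [sum_weight s h]
  refine Nat.geomSum_lt le_rfl fun t ht => ?_
  simp only [mem_image, mem_filter] at ht
  obtain ⟨x, hx, rfl⟩ := ht
  have := h.le x
  omega

/-- Uniqueness of binary expansions; unmatched vertices have weight `0` and leave no mark. -/
theorem mem_of_sum_weight_eq {s t : Finset (Fin n)} (h : Numbering f r)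
    (hst : ∑ x ∈ s, weight f x = ∑ x ∈ t, weight f x) {x : Fin n} (hx : x ∈ s) (hfx : f x ≠ 0) :
    x ∈ t := by
  rw [sum_weight s h, sum_weight t h] at hst
  have := geomSum_injective le_rfl hst
  have hmem : f x - 1 ∈ (s.filter fun x => f x ≠ 0).image fun x => f x - 1 :=
    mem_image_of_mem _ (mem_filter.2 ⟨hx, hfx⟩)
  rw [this] at hmem
  obtain ⟨y, hy, hyx⟩ := mem_image.1 hmem
  have hy' := (mem_filter.1 hy).2
  rw [h.inj x y hfx (by omega)]
  exact (mem_filter.1 hy).1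

/-- The neighbours of `u` along the first `i` edges. -/
def nbrs (a b : ℕ → Fin n) (i : ℕ) (u : Fin n) : Finset (Fin n) :=
  univ.filter fun x => ∃ j < i, s(a j, b j) = s(u, x)

theorem mem_nbrs {u x : Fin n} : x ∈ nbrs a b i u ↔ ∃ j < i, s(a j, b j) = s(u, x) := by
  simp [nbrs]

/-- The total weight of the neighbours along the first `i` edges. -/
def mask (f : Fin n → ℕ) (a b : ℕ → Fin n) (i : ℕ) (u : Fin n) : ℕ :=
  ∑ x ∈ nbrs a b i u, weight f x

theorem mask_zero : mask f a b 0 = fun _ => 0 := by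
  funext u
  simp [mask, nbrs]

theorem mask_succ (h : EdgeSeq G m a b) (hi : i < m) :
    mask f a b (i + 1) =
      update (update (mask f a b i) (a i) (mask f a b i (a i) + weight f (b i)))
        (b i) (mask f a b i (b i) + weight f (a i)) := by
  have hne := (h.adj hi).ne
  -- Every edge is listed once, so no weight is added twice to the same mask.
  have hnew : ∀ u x, s(a i, b i) = s(u, x) → x ∉ nbrs a b i u := by
    intro u x hux hx
    obtain ⟨j, hj, hjx⟩ := mem_nbrs.1 hx
    have := h.inj i hi j (hj.trans hi) (hux.trans hjx.symm)
    omega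
  have hins : ∀ u x, s(a i, b i) = s(u, x) →
      nbrs a b (i + 1) u = insert x (nbrs a b i u) := by
    intro u x hux
    ext y
    rw [mem_insert, mem_nbrs, mem_nbrs]
    constructor
    · rintro ⟨j, hj, hjy⟩
      rcases Nat.lt_succ_iff_lt_or_eq.1 hj with hj | rfl
      · exact Or.inr ⟨j, hj, hjy⟩
      · exact Or.inl (Sym2.congr_right.1 (hjy.symm.trans hux))
    · rintro (rfl | ⟨j, hj, hjy⟩)
      exacts [⟨i, Nat.lt_succ_self i, hux⟩, ⟨j, hj.trans (Nat.lt_succ_self i), hjy⟩]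
  funext u
  rcases eq_or_ne u (b i) with rfl | hub
  · rw [update_self, mask, hins _ _ Sym2.eq_swap, sum_insert (hnew _ _ Sym2.eq_swap), add_comm,
      mask]
  rw [update_of_ne hub]
  rcases eq_or_ne u (a i) with rfl | hua
  · rw [update_self, mask, hins _ _ rfl, sum_insert (hnew _ _ rfl), add_comm, mask]
  rw [update_of_ne hua, mask, mask]
  congr 1
  ext x
  rw [mem_nbrs, mem_nbrs]
  constructor
  · rintro ⟨j, hj, hjx⟩
    rcases Nat.lt_succ_iff_lt_or_eq.1 hj with hj | rfl
    · exact ⟨j, hj, hjx⟩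
    · rcases Sym2.eq_iff.1 hjx with h | h
      · exact (hua h.1.symm).elim
      · exact (hub h.2.symm).elim
  · rintro ⟨j, hj, hjx⟩
    exact ⟨j, hj.trans (Nat.lt_succ_self i), hjx⟩

theorem mask_lt (h : Numbering f r) (u : Fin n) : mask f a b i u < 2 ^ r :=
  sum_weight_lt _ h

/-- Unmatched vertices with the same mask are twins. -/
theorem adj_of_mask_eq (hE : EdgeSeq G m a b) (h : MatchInv G l a b m f r) (hr : r < 2 * l)
    {v w x : Fin n} (hv : f v = 0) (hvw : mask f a b m v = mask f a b m w) (hvx : G.Adj v x) :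
    G.Adj w x := by
  obtain ⟨j, hj, hjx⟩ := (hE.adj_iff v x).1 hvx
  -- As `r < 2 * l`, the matched vertices cover all edges, and `v` is unmatched.
  have hx : f x ≠ 0 := by
    rcases h.cover j hj with h | h | h
    · rcases Sym2.eq_iff.1 hjx with h' | h' <;> simp_all
    · rcases Sym2.eq_iff.1 hjx with h' | h' <;> simp_all
    · omega
  exact (hE.adj_iff w x).2 (mem_nbrs.1 (mem_of_sum_weight_eq h.num hvw (mem_nbrs.2 ⟨j, hj, hjx⟩) hx))

/-- The state of the selection of vertices, after the vertices in `vis` were visited: `g` numbers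
the selected vertices, and `cnt` counts those that are unmatched, for every mask. -/
structure SelectInv (l : ℕ) (f k : Fin n → ℕ) (vis : Set (Fin n)) (g : Fin n → ℕ) (r : ℕ)
    (cnt : ℕ → ℕ) : Prop where
  num : Numbering g r
  extend : ∀ u, f u ≠ 0 → g u ≠ 0
  cnt_eq : ∀ q, cnt q = (univ.filter fun v => g v ≠ 0 ∧ f v = 0 ∧ k v = q).card
  cnt_le : ∀ q, cnt q ≤ 2 * l
  visited : ∀ u ∈ vis, g u ≠ 0 ∨ cnt (k u) = 2 * l

variable {k g : Fin n → ℕ} {vis : Set (Fin n)} {cnt : ℕ → ℕ}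

/-- All matched vertices are selected from the start, and the selection continues their numbering.
-/
theorem SelectInv.zero (h : Numbering f r) : SelectInv l f k ∅ f r (fun _ => 0) := by
  refine ⟨h, fun _ => id, fun q => ?_, fun _ => Nat.zero_le _, fun _ h => h.elim⟩
  rw [eq_comm, card_eq_zero, filter_eq_empty_iff]
  tauto

theorem SelectInv.mono (h : SelectInv l f k vis g r cnt) {vis' : Set (Fin n)} (hv : vis' ⊆ vis) :
    SelectInv l f k vis' g r cnt :=
  ⟨h.num, h.extend, h.cnt_eq, h.cnt_le, fun u hu => h.visited u (hv hu)⟩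

theorem SelectInv.skip (h : SelectInv l f k vis g r cnt) {u : Fin n}
    (hu : g u ≠ 0 ∨ ¬ cnt (k u) < 2 * l) : SelectInv l f k (insert u vis) g r cnt := by
  refine ⟨h.num, h.extend, h.cnt_eq, h.cnt_le, fun v hv => ?_⟩
  rcases hv with rfl | hv
  · exact hu.imp_right fun h' => le_antisymm (h.cnt_le _) (not_lt.1 h')
  · exact h.visited v hv

theorem SelectInv.select (h : SelectInv l f k vis g r cnt) {u : Fin n} (hu : g u = 0)
    (hc : cnt (k u) < 2 * l) :
    SelectInv l f k (insert u vis) (update g u (r + 1)) (r + 1)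
      (update cnt (k u) (cnt (k u) + 1)) := by
  have hfu : f u = 0 := by
    by_contra hf
    exact h.extend u hf hu
  have hmono : ∀ v, g v ≠ 0 → update g u (r + 1) v ≠ 0 := by
    intro v hv
    rw [update_apply]
    split_ifs <;> omega
  refine ⟨h.num.update hu, fun v hv => hmono v (h.extend v hv), fun q => ?_, fun q => ?_, ?_⟩
  · rcases eq_or_ne q (k u) with rfl | hq
    · rw [update_self, h.cnt_eq, ← card_insert_of_notMem (a := u) (by simp [hu])]
      congr 1
      ext v
      rcases eq_or_ne v u with rfl | hvu
      · simp [hfu]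
      · simp [hvu]
    · rw [update_of_ne hq, h.cnt_eq]
      congr 1
      ext v
      rcases eq_or_ne v u with rfl | hvu
      · simp [hu, hq.symm]
      · simp [hvu]
  · have := h.cnt_le q
    rw [update_apply]
    split_ifs <;> omega
  · rintro v (rfl | hv)
    · exact Or.inl (by simp)
    · rcases h.visited v hv with hg | hg
      · exact Or.inl (hmono v hg)
      · refine Or.inr ?_
        -- The class of `v` is full and that of `u` is not, so they are different.
        rw [update_of_ne (fun h' => ?_), hg]
        rw [h'] at hg
        omega

/-- The vertices on the first `i` edges. -/
def visitedBy (a b : ℕ → Fin n) (i : ℕ) : Set (Fin n) := {u | ∃ j < i, u = a j ∨ u = b j}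

theorem visitedBy_zero : visitedBy a b 0 = ∅ := by
  ext u
  simp [visitedBy]

theorem visitedBy_succ : visitedBy a b (i + 1) ⊆ insert (b i) (insert (a i) (visitedBy a b i)) := by
  rintro u ⟨j, hj, hu⟩
  rcases Nat.lt_succ_iff_lt_or_eq.1 hj with hj | rfl
  · exact Or.inr (Or.inr ⟨j, hj, hu⟩)
  · rcases hu with rfl | rfl
    · exact Or.inr (Or.inl rfl)
    · exact Or.inl rfl

/-- Unmatched twins have equal masks and share a counter, which never exceeds `2 * l`. This is the
hypothesis on twins in `card_le_of_not_hasStrong`. -/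
theorem SelectInv.card_le {r' : ℕ} (hE : EdgeSeq G m a b) (h : MatchInv G l a b m f r)
    (hs : SelectInv l f (mask f a b m) vis g r' cnt)
    (hno : ¬ HasStrong G l) : r' ≤ 4 * l * 2 ^ l := by
  rw [← hs.num.card_filter]
  refine card_le_of_not_hasStrong hno (X := univ.filter fun v => f v ≠ 0) ?_ ?_
  · rw [h.num.card_filter]
    exact h.le
  · intro D hDK hDX hD
    rcases D.eq_empty_or_nonempty with rfl | ⟨v, hv⟩
    · simp
    · refine le_trans (card_le_card fun w hw => ?_)
        ((hs.cnt_eq (mask f a b m v)).symm.trans_le (hs.cnt_le _))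
      have hw1 := hDK hw
      have hw2 := hDX w hw
      simp only [mem_filter, mem_univ, true_and, ne_eq, not_not] at hw1 hw2 ⊢
      refine ⟨hw1, hw2, ?_⟩
      rw [mask, mask]
      congr 1
      ext x
      rw [mem_nbrs, mem_nbrs, ← hE.adj_iff, ← hE.adj_iff]
      exact ⟨hD w hw v hv x, hD v hv w hw x⟩

/-- Having a neighbour, `v` was visited; it was refused only because its class already had `2 * l`
selected members. Isolated vertices are not visited and need no substitute. -/
theorem SelectInv.exists_twins {r' : ℕ} (hE : EdgeSeq G m a b) (h : MatchInv G l a b m f r)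
    (hr : r < 2 * l) (hs : SelectInv l f (mask f a b m) (visitedBy a b m) g r' cnt)
    {v x : Fin n} (hv : g v = 0) (hvx : G.Adj v x) :
    ∃ D : Finset (Fin n), 2 * l ≤ D.card ∧ ∀ w ∈ D, g w ≠ 0 ∧ ∀ y, G.Adj w y ↔ G.Adj v y := by
  have hfv : f v = 0 := by
    by_contra hf
    exact hs.extend v hf hv
  obtain ⟨j, hj, hjx⟩ := (hE.adj_iff v x).1 hvx
  have hvis : v ∈ visitedBy a b m := by
    refine ⟨j, hj, ?_⟩
    rcases Sym2.eq_iff.1 hjx with h' | h'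
    · exact Or.inl h'.1.symm
    · exact Or.inr h'.2.symm
  have hc := (hs.visited v hvis).resolve_left (not_not.2 hv)
  refine ⟨_, (hc.symm.trans (hs.cnt_eq _)).le, fun w hw => ?_⟩
  simp only [mem_filter, mem_univ, true_and] at hw
  exact ⟨hw.1, fun y => ⟨adj_of_mask_eq hE h hr hw.2.1 hw.2.2,
    adj_of_mask_eq hE h hr hfv hw.2.2.symm⟩⟩

end

end STC

/-! ### The passes over the edges and their memory layout -/

namespace STC

open RAM Function

/-- Sequential composition of a list of programs. -/
def seqs : List Prog → Prog
  | [] => .skip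
  | p :: ps => .seq p (seqs ps)

/-- Greedy matching: treat the edge at the read position. -/
def matchBody : Prog := seqs [
  -- Register 16 is the read position, 17 and 18 are the endpoints. Registers 9 to 12 hold the bases
  -- of the arrays of weights, masks, numbers and counters. Register 14 is the last number given,
  -- and 15 the next power of two.
  .load 17 16, .add 16 16 1, .load 18 16, .add 16 16 1,
  .add 19 11 17, .load 20 19, .add 21 11 18, .load 22 21,
  .ite (.lt 0 20) .skip (.ite (.lt 0 22) .skip (.ite (.lt 14 13) (seqs [
    .add 14 14 1, .store 19 14, .add 14 14 1, .store 21 14,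
    .add 23 9 17, .store 23 15, .add 15 15 15,
    .add 24 9 18, .store 24 15, .add 15 15 15]) .skip))]

/-- Add the weight of each endpoint of the edge at the read position to the mask of the other. -/
def maskBody : Prog := seqs [
  .load 17 16, .add 16 16 1, .load 18 16, .add 16 16 1,
  .add 19 9 17, .load 20 19, .add 21 9 18, .load 22 21,
  .add 23 10 17, .load 24 23, .add 24 24 22, .store 23 24,
  .add 23 10 18, .load 24 23, .add 24 24 20, .store 23 24]

/-- Select the vertex in register `d`, unless it is selected or its class is full. -/
def visit (d : ℕ) : Prog := seqs [
  .add 19 11 d, .load 20 19,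
  .ite (.lt 0 20) .skip (seqs [
    .add 21 10 d, .load 21 21, .add 21 12 21, .load 22 21,
    .ite (.lt 22 13) (seqs [.add 22 22 1, .store 21 22, .add 14 14 1, .store 19 14]) .skip])]

/-- Visit both endpoints of the edge at the read position. -/
def selectBody : Prog := seqs [
  .load 17 16, .add 16 16 1, .load 18 16, .add 16 16 1, visit 17, visit 18]

/-- Write the edge at the read position to the output if both endpoints are selected. -/
def outBody : Prog := seqs [
  .load 17 16, .add 16 16 1, .load 18 16, .add 16 16 1,
  .add 19 11 17, .load 20 19, .add 21 11 18, .load 22 21,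
  .ite (.lt 0 20) (.ite (.lt 0 22) (seqs [
    -- Numbers start at 1 because 0 means unselected, but vertices of the output start at 0.
    -- Register 25 is the write position, 26 counts the edges.
    .sub 20 20 1, .store 25 20, .add 25 25 1, .sub 22 22 1, .store 25 22, .add 25 25 1,
    .add 26 26 1]) .skip) .skip]

/-- The registers that stay constant during the passes over the edges. -/
structure Ctx (n m l : ℕ) (ρ : ℕ → ℕ) : Prop where
  r0 : ρ 0 = 0
  r1 : ρ 1 = 1
  r4 : ρ 4 = 2
  r6 : ρ 6 = l
  r7 : ρ 7 = 4 * l * 2 ^ l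
  r9 : ρ 9 = 3 + 2 * m
  r10 : ρ 10 = 3 + 2 * m + n
  r11 : ρ 11 = 3 + 2 * m + 2 * n
  r12 : ρ 12 = 3 + 2 * m + 3 * n
  r13 : ρ 13 = 2 * l

theorem Ctx.update {n m l : ℕ} {ρ : ℕ → ℕ} (h : Ctx n m l ρ) {d v : ℕ} (hd : 14 ≤ d) :
    Ctx n m l (update ρ d v) := by
  obtain ⟨h0, h1, h4, h6, h7, h9, h10, h11, h12, h13⟩ := h
  constructor <;> rw [update_of_ne (by omega)] <;> assumption

/-- The memory holds the edges from number `i` on, and behind the edges three arrays indexed by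
vertices and one that is indexed by masks. -/
structure Mem {n : ℕ} (m : ℕ) (a b : ℕ → Fin n) (i : ℕ) (val k f : Fin n → ℕ) (cnt : ℕ → ℕ)
    (μ : ℕ → ℕ) : Prop where
  fst : ∀ j, i ≤ j → j < m → μ (3 + 2 * j) = a j
  snd : ∀ j, i ≤ j → j < m → μ (3 + 2 * j + 1) = b j
  val : ∀ u : Fin n, μ (3 + 2 * m + u) = val u
  mask : ∀ u : Fin n, μ (3 + 2 * m + n + u) = k u
  num : ∀ u : Fin n, μ (3 + 2 * m + 2 * n + u) = f u
  cnt : ∀ q, μ (3 + 2 * m + 3 * n + q) = cnt q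

section

variable {n m l i B : ℕ} {a b : ℕ → Fin n} {val k f : Fin n → ℕ} {cnt : ℕ → ℕ} {μ : ℕ → ℕ}

theorem Mem.setVal (h : Mem m a b i val k f cnt μ) (u : Fin n) (x : ℕ) :
    Mem m a b i (update val u x) k f cnt (update μ (3 + 2 * m + u) x) := by
  refine ⟨fun j h1 h2 => ?_, fun j h1 h2 => ?_, fun v => ?_, fun v => ?_, fun v => ?_,
    fun q => ?_⟩
  · rw [update_of_ne (by omega), h.fst j h1 h2]
  · rw [update_of_ne (by omega), h.snd j h1 h2]
  · rcases eq_or_ne v u with rfl | hv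
    · rw [update_self, update_self]
    · rw [update_of_ne hv, update_of_ne (by omega), h.val]
  · rw [update_of_ne (by omega), h.mask]
  · rw [update_of_ne (by omega), h.num]
  · rw [update_of_ne (by omega), h.cnt]

theorem Mem.setMask (h : Mem m a b i val k f cnt μ) (u : Fin n) (x : ℕ) :
    Mem m a b i val (update k u x) f cnt (update μ (3 + 2 * m + n + u) x) := by
  refine ⟨fun j h1 h2 => ?_, fun j h1 h2 => ?_, fun v => ?_, fun v => ?_, fun v => ?_,
    fun q => ?_⟩
  · rw [update_of_ne (by omega), h.fst j h1 h2]
  · rw [update_of_ne (by omega), h.snd j h1 h2]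
  · rw [update_of_ne (by omega), h.val]
  · rcases eq_or_ne v u with rfl | hv
    · rw [update_self, update_self]
    · rw [update_of_ne hv, update_of_ne (by omega), h.mask]
  · rw [update_of_ne (by omega), h.num]
  · rw [update_of_ne (by omega), h.cnt]

theorem Mem.setNum (h : Mem m a b i val k f cnt μ) (u : Fin n) (x : ℕ) :
    Mem m a b i val k (update f u x) cnt (update μ (3 + 2 * m + 2 * n + u) x) := by
  refine ⟨fun j h1 h2 => ?_, fun j h1 h2 => ?_, fun v => ?_, fun v => ?_, fun v => ?_,
    fun q => ?_⟩
  · rw [update_of_ne (by omega), h.fst j h1 h2]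
  · rw [update_of_ne (by omega), h.snd j h1 h2]
  · rw [update_of_ne (by omega), h.val]
  · rw [update_of_ne (by omega), h.mask]
  · rcases eq_or_ne v u with rfl | hv
    · rw [update_self, update_self]
    · rw [update_of_ne hv, update_of_ne (by omega), h.num]
  · rw [update_of_ne (by omega), h.cnt]

theorem Mem.setCnt (h : Mem m a b i val k f cnt μ) (q x : ℕ) :
    Mem m a b i val k f (update cnt q x) (update μ (3 + 2 * m + 3 * n + q) x) := by
  refine ⟨fun j h1 h2 => ?_, fun j h1 h2 => ?_, fun v => ?_, fun v => ?_, fun v => ?_,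
    fun p => ?_⟩
  · rw [update_of_ne (by omega), h.fst j h1 h2]
  · rw [update_of_ne (by omega), h.snd j h1 h2]
  · rw [update_of_ne (by omega), h.val]
  · rw [update_of_ne (by omega), h.mask]
  · rw [update_of_ne (by omega), h.num]
  · rcases eq_or_ne p q with rfl | hv
    · rw [update_self, update_self]
    · rw [update_of_ne hv, update_of_ne (by omega), h.cnt]

/-- Writing to the part of the input that has been read. -/
theorem Mem.setOld (h : Mem m a b i val k f cnt μ) {p : ℕ} (hp : p < 3 + 2 * i) (hi : i ≤ m)
    (x : ℕ) : Mem m a b i val k f cnt (update μ p x) := by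
  refine ⟨fun j h1 h2 => ?_, fun j h1 h2 => ?_, fun v => ?_, fun v => ?_, fun v => ?_,
    fun q => ?_⟩
  · rw [update_of_ne (by omega), h.fst j h1 h2]
  · rw [update_of_ne (by omega), h.snd j h1 h2]
  · rw [update_of_ne (by omega), h.val]
  · rw [update_of_ne (by omega), h.mask]
  · rw [update_of_ne (by omega), h.num]
  · rw [update_of_ne (by omega), h.cnt]

theorem Mem.mono (h : Mem m a b i val k f cnt μ) {i' : ℕ} (hi : i ≤ i') :
    Mem m a b i' val k f cnt μ :=
  ⟨fun j h1 h2 => h.fst j (hi.trans h1) h2, fun j h1 h2 => h.snd j (hi.trans h1) h2,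
    h.val, h.mask, h.num, h.cnt⟩

variable {G : SimpleGraph (Fin n)}

/-- The words are large enough for all numbers that occur in the passes. -/
structure Wide (n m l B : ℕ) : Prop where
  lt : 3 + 2 * m + 4 * n + 2 * l + 4 * 2 ^ (2 * l) + 4 < B

theorem wp_matchBody (hw : Wide n m l B) (hE : EdgeSeq G m a b) (hi : i < m) {s : State}
    (hc : Ctx n m l s.reg) (h16 : s.reg 16 = 3 + 2 * i) {f : Fin n → ℕ} {r : ℕ}
    (hM : Mem m a b 0 (weight f) k f cnt s.mem) (h14 : s.reg 14 = r) (h15 : s.reg 15 = 2 ^ r)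
    (hf : MatchInv G l a b i f r) :
    matchBody.wp B (fun s => Ctx n m l s.reg ∧ s.reg 16 = 3 + 2 * (i + 1) ∧ ∃ f r,
      Mem m a b 0 (weight f) k f cnt s.mem ∧ s.reg 14 = r ∧ s.reg 15 = 2 ^ r ∧
      MatchInv G l a b (i + 1) f r) s := by
  have hB := hw.lt
  have ha := (a i).2
  have hb := (b i).2
  have hfa := hf.num.le (a i)
  have hfb := hf.num.le (b i)
  have hr := hf.le
  have hrp : 2 ^ r ≤ 2 ^ (2 * l) := Nat.pow_le_pow_right (by norm_num) hr
  have hpos := Nat.one_le_two_pow (n := 2 * l)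
  simp only [matchBody, seqs, Prog.wp, State.setReg, State.setMem, Test.Holds, update_self,
    update_of_ne, ne_eq, Nat.reduceEqDiff, not_false_eq_true, OfNat.zero_ne_ofNat,
    OfNat.one_ne_ofNat, h16, hc.r0, hc.r1, hc.r9, hc.r11, hc.r13, hM.fst i (Nat.zero_le _) hi,
    hM.snd i (Nat.zero_le _) hi, hM.num, h14, h15]
  refine ⟨by omega, by omega, by omega, by omega, by omega, by omega, by omega, by omega,
    fun h1 => ⟨?_, by omega, f, r, hM, rfl, rfl, hf.skip (by omega)⟩, fun h1 =>
    ⟨fun h2 => ⟨?_, by omega, f, r, hM, rfl, rfl, hf.skip (by omega)⟩, fun h2 =>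
    ⟨fun h3 => ⟨by omega, by omega, by omega, by omega, by omega, by omega, ?_, by omega,
      _, _, ?_, rfl, by ring, hf.match (hE.adj hi) (by omega) (by omega) h3⟩,
    fun h3 => ⟨?_, by omega, f, r, hM, rfl, rfl, hf.skip (by omega)⟩⟩⟩⟩
  case refine_4 =>
    rw [weight_update, weight_update, pow_succ, mul_two]
    exact (((hM.setNum _ _).setNum _ _).setVal _ _).setVal _ _
  all_goals repeat first | exact hc | refine Ctx.update ?_ (by norm_num)

theorem wp_maskBody (hw : Wide n m l B) (hE : EdgeSeq G m a b) (hi : i < m) {s : State}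
    (hc : Ctx n m l s.reg) (h16 : s.reg 16 = 3 + 2 * i) {f : Fin n → ℕ} {r : ℕ}
    (hM : Mem m a b 0 (weight f) (mask f a b i) f cnt s.mem) (h14 : s.reg 14 = r)
    (hf : Numbering f r) (hr : r ≤ 2 * l) :
    maskBody.wp B (fun s => Ctx n m l s.reg ∧ s.reg 16 = 3 + 2 * (i + 1) ∧
      Mem m a b 0 (weight f) (mask f a b (i + 1)) f cnt s.mem ∧ s.reg 14 = r) s := by
  have hB := hw.lt
  have ha := (a i).2
  have hb := (b i).2
  have hrp : 2 ^ r ≤ 2 ^ (2 * l) := Nat.pow_le_pow_right (by norm_num) hr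
  have hne := (hE.adj hi).ne'
  have hma : mask f a b i (a i) < 2 ^ r := mask_lt hf _
  have hmb : mask f a b i (b i) < 2 ^ r := mask_lt hf _
  have hwa : weight f (a i) < 2 ^ r := by simpa using sum_weight_lt {a i} hf
  have hwb : weight f (b i) < 2 ^ r := by simpa using sum_weight_lt {b i} hf
  have hM' := hM.setMask (a i) (mask f a b i (a i) + weight f (b i))
  -- The mask of `b i` is read after that of `a i` was stored; the ends differ, so it is still the
  -- old value.
  have hb' := hM'.mask (b i)
  rw [update_of_ne hne] at hb'
  simp only [maskBody, seqs, Prog.wp, State.setReg, State.setMem, update_self,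
    update_of_ne, ne_eq, Nat.reduceEqDiff, not_false_eq_true,
    OfNat.one_ne_ofNat, h16, hc.r1, hc.r9, hc.r10, hM.fst i (Nat.zero_le _) hi,
    hM.snd i (Nat.zero_le _) hi, hM.val, hM.mask, h14, hb']
  refine ⟨by omega, by omega, by omega, by omega, by omega, by omega, by omega, by omega,
    by omega, by omega, by omega, by omega, by omega, by omega, ?_, by omega, ?_, trivial⟩
  · repeat first | exact hc | refine Ctx.update ?_ (by norm_num)
  · rw [mask_succ hE hi]
    exact hM'.setMask _ _

/-- Registers 16 and 18 are tracked because the second endpoint and the read position are still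
needed after the first visit. -/
theorem wp_visit (hw : Wide n m l B) {s : State} (hc : Ctx n m l s.reg) {d : ℕ} {u : Fin n}
    (hd : s.reg d = u) (hd' : d = 17 ∨ d = 18) {f g : Fin n → ℕ} {vis : Set (Fin n)} {r : ℕ}
    (hM : Mem m a b 0 val k g cnt s.mem) (h14 : s.reg 14 = r)
    (hk : ∀ u, k u < 2 ^ (2 * l)) (hs : SelectInv l f k vis g r cnt) :
    (visit d).wp B (fun s' => Ctx n m l s'.reg ∧ s'.reg 16 = s.reg 16 ∧ s'.reg 18 = s.reg 18 ∧
      ∃ g r cnt, Mem m a b 0 val k g cnt s'.mem ∧ s'.reg 14 = r ∧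
        SelectInv l f k (insert u vis) g r cnt) s := by
  have hB := hw.lt
  have hu := u.2
  have hku := hk u
  have hr := hs.num.le_card
  have hgu := hs.num.le u
  have hcu := hs.cnt_le (k u)
  have hd1 : d ≠ 19 := by omega
  have hd2 : d ≠ 20 := by omega
  simp only [visit, seqs, Prog.wp, State.setReg, State.setMem, Test.Holds, update_self,
    update_of_ne, ne_eq, Nat.reduceEqDiff, not_false_eq_true, OfNat.zero_ne_ofNat,
    OfNat.one_ne_ofNat, hd, hd1, hd2, hc.r0, hc.r1, hc.r10, hc.r11, hc.r12, hc.r13, hM.num,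
    hM.mask, hM.cnt, h14]
  refine ⟨by omega, by omega, fun h1 => ⟨?_, trivial, trivial, g, r, cnt, hM, rfl,
      hs.skip (by omega)⟩,
    fun h1 => ⟨by omega, by omega, by omega, by omega, fun h2 => ⟨by omega, by omega, ?_, trivial,
      trivial, _, _, _, (hM.setCnt _ _).setNum _ _, rfl, hs.select (by omega) h2⟩,
      fun h2 => ⟨?_, trivial, trivial, g, r, cnt, hM, rfl, hs.skip (by omega)⟩⟩⟩
  all_goals repeat first | exact hc | refine Ctx.update ?_ (by norm_num)

theorem wp_selectBody (hw : Wide n m l B) (hi : i < m) {s : State}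
    (hc : Ctx n m l s.reg) (h16 : s.reg 16 = 3 + 2 * i) {f g : Fin n → ℕ} {r : ℕ}
    (hM : Mem m a b 0 val k g cnt s.mem) (h14 : s.reg 14 = r)
    (hk : ∀ u, k u < 2 ^ (2 * l)) (hs : SelectInv l f k (visitedBy a b i) g r cnt) :
    selectBody.wp B (fun s => Ctx n m l s.reg ∧ s.reg 16 = 3 + 2 * (i + 1) ∧
      ∃ g r cnt, Mem m a b 0 val k g cnt s.mem ∧ s.reg 14 = r ∧
        SelectInv l f k (visitedBy a b (i + 1)) g r cnt) s := by
  have hB := hw.lt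
  have ha := (a i).2
  have hb := (b i).2
  simp only [selectBody, seqs, Prog.wp, State.setReg, update_self,
    update_of_ne, ne_eq, Nat.reduceEqDiff, not_false_eq_true,
    OfNat.one_ne_ofNat, h16, hc.r1, hM.fst i (Nat.zero_le _) hi,
    hM.snd i (Nat.zero_le _) hi]
  refine ⟨by omega, by omega, by omega, by omega, ?_⟩
  refine Prog.wp.mono
    (wp_visit (a := a) (b := b) (d := 17) (u := a i) (val := val) hw ?_ ?_ (Or.inl rfl) ?_ ?_ hk
      hs) ?_
  · repeat first | exact hc | refine Ctx.update ?_ (by norm_num)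
  · simp
  · exact hM
  · simpa using h14
  rintro s₁ ⟨hc₁, h16₁, h18₁, g₁, r₁, cnt₁, hM₁, h14₁, hs₁⟩
  refine (wp_visit (d := 18) (u := b i) hw hc₁ ?_ (Or.inr rfl) hM₁ h14₁ hk hs₁).mono ?_
  · simp [h18₁]
  rintro s₂ ⟨hc₂, h16₂, -, g₂, r₂, cnt₂, hM₂, h14₂, hs₂⟩
  refine ⟨hc₂, ?_, g₂, r₂, cnt₂, hM₂, h14₂, hs₂.mono visitedBy_succ⟩
  rw [h16₂, h16₁]
  simp
  ring

/-- The sequence of the endpoints of a list of edges. -/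
def flat (L : List (ℕ × ℕ)) : List ℕ := L.flatMap fun e => [e.1, e.2]

theorem length_flat (L : List (ℕ × ℕ)) : (flat L).length = 2 * L.length := by
  simp [flat, List.length_flatMap, mul_comm]

/-- The list of edges stands in the memory behind the first three cells. -/
def Written (L : List (ℕ × ℕ)) (μ : ℕ → ℕ) : Prop :=
  ∀ t < 2 * L.length, μ (3 + t) = (flat L).getD t 0

theorem Written.snoc {L : List (ℕ × ℕ)} (h : Written L μ) (x y : ℕ) :
    Written (L ++ [(x, y)])
      (update (update μ (3 + 2 * L.length) x) (3 + 2 * L.length + 1) y) := by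
  intro t ht
  have hflat : flat (L ++ [(x, y)]) = flat L ++ [x, y] := by simp [flat]
  rw [List.length_append, List.length_singleton] at ht
  rw [hflat]
  rcases lt_or_ge t (2 * L.length) with h1 | h1
  · rw [update_of_ne (by omega), update_of_ne (by omega), h t h1,
      List.getD_append _ _ _ _ (by rwa [length_flat])]
  · rw [List.getD_append_right _ _ _ _ (by rwa [length_flat]), length_flat]
    obtain rfl | rfl : t = 2 * L.length ∨ t = 2 * L.length + 1 := by omega
    · rw [update_of_ne (by omega), update_self]
      simp
    · rw [← add_assoc, update_self]
      simp

/-- The numbers of those edges among the first `i` that have two selected endpoints. -/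
def keptEdges (g : Fin n → ℕ) (a b : ℕ → Fin n) (i : ℕ) : List ℕ :=
  (List.range i).filter fun j => g (a j) ≠ 0 ∧ g (b j) ≠ 0

/-- The edges with two selected endpoints, in the new numbering. -/
def outEdges (g : Fin n → ℕ) (a b : ℕ → Fin n) (i : ℕ) : List (ℕ × ℕ) :=
  (keptEdges g a b i).map fun j => (g (a j) - 1, g (b j) - 1)

theorem length_outEdges_le (g : Fin n → ℕ) : (outEdges g a b i).length ≤ i := by
  simpa [outEdges, keptEdges] using
    List.length_filter_le (fun j => g (a j) ≠ 0 ∧ g (b j) ≠ 0) (List.range i)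

theorem outEdges_succ_of_mem {g : Fin n → ℕ} (ha : g (a i) ≠ 0) (hb : g (b i) ≠ 0) :
    outEdges g a b (i + 1) = outEdges g a b i ++ [(g (a i) - 1, g (b i) - 1)] := by
  simp [outEdges, keptEdges, List.range_succ, List.filter_append, ha, hb]

theorem outEdges_succ_of_notMem {g : Fin n → ℕ} (h : g (a i) = 0 ∨ g (b i) = 0) :
    outEdges g a b (i + 1) = outEdges g a b i := by
  rcases h with h | h <;> simp [outEdges, keptEdges, List.range_succ, List.filter_append, h]

/-- The output overwrites the input in place: at most `i` edges have been written when `i` have been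
read, so only edges already read are lost. -/
theorem wp_outBody (hw : Wide n m l B) (hi : i < m) {s : State}
    (hc : Ctx n m l s.reg) (h16 : s.reg 16 = 3 + 2 * i) {g : Fin n → ℕ} {r : ℕ}
    (hM : Mem m a b i val k g cnt s.mem) (h14 : s.reg 14 = r) (hg : Numbering g r)
    (h25 : s.reg 25 = 3 + 2 * (outEdges g a b i).length)
    (h26 : s.reg 26 = (outEdges g a b i).length) (hW : Written (outEdges g a b i) s.mem) :
    outBody.wp B (fun s => Ctx n m l s.reg ∧ s.reg 16 = 3 + 2 * (i + 1) ∧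
      Mem m a b (i + 1) val k g cnt s.mem ∧ s.reg 14 = r ∧
      s.reg 25 = 3 + 2 * (outEdges g a b (i + 1)).length ∧
      s.reg 26 = (outEdges g a b (i + 1)).length ∧ Written (outEdges g a b (i + 1)) s.mem) s := by
  have hB := hw.lt
  have ha := (a i).2
  have hb := (b i).2
  have hr := hg.le_card
  have hga := hg.le (a i)
  have hgb := hg.le (b i)
  have hlen := length_outEdges_le (a := a) (b := b) (i := i) g
  simp only [outBody, seqs, Prog.wp, State.setReg, State.setMem, Test.Holds, update_self,
    update_of_ne, ne_eq, Nat.reduceEqDiff, not_false_eq_true, OfNat.zero_ne_ofNat,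
    OfNat.one_ne_ofNat, h16, h25, h26, hc.r0, hc.r1, hc.r11, hM.fst i le_rfl hi,
    hM.snd i le_rfl hi, hM.num, h14]
  refine ⟨by omega, by omega, by omega, by omega, by omega, by omega, by omega, by omega,
    fun h1 => ⟨fun h2 => ⟨by omega, by omega, by omega, by omega, by omega, ?_⟩, fun h2 => ?_⟩,
    fun h1 => ?_⟩
  · rw [outEdges_succ_of_mem h1.ne' h2.ne', List.length_append, List.length_singleton]
    refine ⟨?_, by omega, ?_, trivial, by omega, rfl, hW.snoc _ _⟩
    · repeat first | exact hc | refine Ctx.update ?_ (by norm_num)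
    · exact ((hM.mono (Nat.le_succ i)).setOld (by omega) hi _).setOld (by omega) hi _
  all_goals
    rw [outEdges_succ_of_notMem (by omega)]
    refine ⟨?_, by omega, hM.mono (Nat.le_succ i), trivial, rfl, rfl, hW⟩
    repeat first | exact hc | refine Ctx.update ?_ (by norm_num)

end

end STC

/-! ### The whole program and its running time -/

namespace STC

open RAM Function

/-- Output the empty graph. -/
def trivialOut : Prog := seqs [.store 0 0, .store 1 0, .store 4 0]

/-- Output the subgraph induced by the selected vertices. -/
def writeOut : Prog :=
  .seq (seqs [.add 16 4 1, .add 25 4 1, .const 26 0])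
    (.seq (.loop (.lt 16 9) outBody)
      (seqs [.sub 27 26 6, .store 0 14, .store 1 26, .store 4 27]))

/-- Compute the masks, select the vertices and write the output. -/
def classify : Prog :=
  .seq (.add 16 4 1) (.seq (.loop (.lt 16 9) maskBody)
    (.seq (.add 16 4 1) (.seq (.loop (.lt 16 9) selectBody)
      -- More selected vertices than the threshold in register 7 certify a yes-instance.
      (.ite (.lt 7 14) trivialOut writeOut))))

/-- The kernelization for instances with many vertices. -/
def kernelize : Prog :=
  .seq (seqs [.add 9 3 3, .add 9 9 1, .add 9 9 4, .add 10 9 2, .add 11 10 2, .add 12 11 2,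
    .add 13 6 6, .const 14 0, .const 15 1, .add 16 4 1])
    (.seq (.loop (.lt 16 9) matchBody) (.ite (.lt 14 13) classify trivialOut))

/-- Read `n`, `m`, `k` and compute `m - k`. -/
def prologue : Prog :=
  seqs [.const 0 0, .const 1 1, .load 2 0, .load 3 1, .add 4 1 1, .load 5 4, .sub 6 3 5]

/-- Double the threshold in register `7`, unless it exceeds the number of vertices. -/
def doubleBody : Prog := seqs [.ite (.lt 2 7) .skip (.add 7 7 7), .add 8 8 1]

/-- The kernelization program. -/
def program : Prog :=
  .seq prologue (.ite (.lt 0 6)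
    (.seq (seqs [.add 7 6 6, .add 7 7 7, .const 8 0])
      -- Past `n` the exact threshold is irrelevant, since the input is then already small enough.
      -- Stopping there keeps the register within a word.
      (.seq (.loop (.lt 8 6) doubleBody) (.ite (.lt 2 7) .skip kernelize)))
    trivialOut)

/-- What the program leaves in the memory if it does not keep the input: the empty graph, or
the subgraph induced by the vertices that are numbered by `g`. -/
def Outcome {n : ℕ} (G : SimpleGraph (Fin n)) (l m : ℕ) (a b : ℕ → Fin n) (μ : ℕ → ℕ) : Prop :=
  (μ 0 = 0 ∧ μ 1 = 0 ∧ μ 2 = 0 ∧ HasStrong G l) ∨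
  ∃ f r g r' cnt, MatchInv G l a b m f r ∧ r < 2 * l ∧
    SelectInv l f (mask f a b m) (visitedBy a b m) g r' cnt ∧ r' ≤ 4 * l * 2 ^ l ∧ μ 0 = r' ∧
    μ 1 = (outEdges g a b m).length ∧ μ 2 = (outEdges g a b m).length - l ∧
    Written (outEdges g a b m) μ

section

variable {n m l B : ℕ} {a b : ℕ → Fin n} {val k : Fin n → ℕ} {cnt : ℕ → ℕ}
  {G : SimpleGraph (Fin n)}

theorem runs_trivialOut {s : State} (h0 : s.reg 0 = 0) (h1 : s.reg 1 = 1) (h4 : s.reg 4 = 2) :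
    Runs B trivialOut s 4 (fun s => s.mem 0 = 0 ∧ s.mem 1 = 0 ∧ s.mem 2 = 0) := by
  refine Prog.wp.runs (P := trivialOut) ?_
  simp [trivialOut, seqs, Prog.wp, State.setMem, h0, h1, h4]

theorem runs_writeOut (hw : Wide n m l B) {s : State} (hc : Ctx n m l s.reg)
    {g : Fin n → ℕ} {r : ℕ} (hM : Mem m a b 0 val k g cnt s.mem) (h14 : s.reg 14 = r)
    (hg : Numbering g r) :
    Runs B writeOut s (41 * m + 20) (fun s => s.mem 0 = r ∧ s.mem 1 = (outEdges g a b m).length ∧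
      s.mem 2 = (outEdges g a b m).length - l ∧ Written (outEdges g a b m) s.mem) := by
  have hB := hw.lt
  have hlen := length_outEdges_le (a := a) (b := b) (i := m) g
  refine Runs.mono (Runs.seq (Prog.wp.runs (Q := fun s => Ctx n m l s.reg ∧
      s.reg 16 = 3 + 2 * 0 ∧ Mem m a b 0 val k g cnt s.mem ∧ s.reg 14 = r ∧
      s.reg 25 = 3 + 2 * (outEdges g a b 0).length ∧
      s.reg 26 = (outEdges g a b 0).length ∧ Written (outEdges g a b 0) s.mem) ?_) fun s₁ h₁ =>
    Runs.seq (Runs.loop (fun i s => Ctx n m l s.reg ∧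
      s.reg 16 = 3 + 2 * i ∧ Mem m a b i val k g cnt s.mem ∧ s.reg 14 = r ∧
      s.reg 25 = 3 + 2 * (outEdges g a b i).length ∧
      s.reg 26 = (outEdges g a b i).length ∧ Written (outEdges g a b i) s.mem) m 40 h₁ ?_ ?_)
      fun s₂ h₂ => Prog.wp.runs (Q := fun s => s.mem 0 = r ∧
        s.mem 1 = (outEdges g a b m).length ∧ s.mem 2 = (outEdges g a b m).length - l ∧
        Written (outEdges g a b m) s.mem) ?_) ?_ fun _ h => h
  · simp only [seqs, Prog.wp, State.setReg, update_self, update_of_ne, ne_eq, Nat.reduceEqDiff,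
      not_false_eq_true, OfNat.one_ne_ofNat, hc.r1, hc.r4, h14]
    refine ⟨by omega, by omega, by omega, ?_, trivial, hM, trivial, ?_, ?_, ?_⟩
    · repeat first | exact hc | refine Ctx.update ?_ (by norm_num)
    all_goals simp [outEdges, keptEdges, Written]
  · rintro i hi s ⟨hc, h16, hM, h14, h25, h26, hW⟩
    refine ⟨?_, (wp_outBody hw hi hc h16 hM h14 hg h25 h26 hW).runs.mono (by decide) fun _ h => h⟩
    rw [Test.Holds, h16, hc.r9]
    omega
  · rintro s ⟨hc, h16, -⟩
    rw [Test.Holds, h16, hc.r9]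
    omega
  · obtain ⟨hc, h16, hM, h14, h25, h26, hW⟩ := h₂
    simp only [seqs, Prog.wp, State.setReg, State.setMem, update_self, update_of_ne, ne_eq,
      Nat.reduceEqDiff, not_false_eq_true, OfNat.zero_ne_ofNat, OfNat.one_ne_ofNat,
      zero_ne_one, hc.r0, hc.r1, hc.r4,
      hc.r6, h14, h26]
    refine ⟨by omega, trivial, trivial, trivial, fun t ht => ?_⟩
    rw [update_of_ne (by omega), update_of_ne (by omega), update_of_ne (by omega), hW t ht]
  · simp only [seqs, Prog.cost]
    omega

theorem runs_classify (hw : Wide n m l B) (hE : EdgeSeq G m a b) {s : State}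
    (hc : Ctx n m l s.reg) {f : Fin n → ℕ} {r : ℕ}
    (hM : Mem m a b 0 (weight f) (fun _ => 0) f (fun _ => 0) s.mem) (h14 : s.reg 14 = r)
    (hf : MatchInv G l a b m f r) (hr : r < 2 * l) :
    Runs B classify s (123 * m + 50) (fun s => Outcome G l m a b s.mem) := by
  have hB := hw.lt
  refine Runs.mono (Runs.seq (Prog.wp.runs (Q := fun s => Ctx n m l s.reg ∧
      s.reg 16 = 3 + 2 * 0 ∧ Mem m a b 0 (weight f) (mask f a b 0) f (fun _ => 0) s.mem ∧
      s.reg 14 = r) ?_) fun s₁ h₁ =>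
    Runs.seq (Runs.loop (fun i s => Ctx n m l s.reg ∧
      s.reg 16 = 3 + 2 * i ∧ Mem m a b 0 (weight f) (mask f a b i) f (fun _ => 0) s.mem ∧
      s.reg 14 = r) m 40 h₁ ?_ ?_) fun s₂ h₂ =>
    Runs.seq (Prog.wp.runs (Q := fun s => Ctx n m l s.reg ∧
      s.reg 16 = 3 + 2 * 0 ∧ ∃ g r cnt, Mem m a b 0 (weight f) (mask f a b m) g cnt s.mem ∧
      s.reg 14 = r ∧ SelectInv l f (mask f a b m) (visitedBy a b 0) g r cnt) ?_) fun s₃ h₃ =>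
    Runs.seq (Runs.loop (fun i s => Ctx n m l s.reg ∧
      s.reg 16 = 3 + 2 * i ∧ ∃ g r cnt, Mem m a b 0 (weight f) (mask f a b m) g cnt s.mem ∧
      s.reg 14 = r ∧ SelectInv l f (mask f a b m) (visitedBy a b i) g r cnt) m 40 h₃ ?_ ?_)
      fun s₄ h₄ => Runs.ite (T := 41 * m + 20) (fun ht => ?_) (fun ht => ?_)) ?_ fun _ h => h
  · simp only [Prog.wp, State.setReg, update_self, update_of_ne, ne_eq, Nat.reduceEqDiff,
      not_false_eq_true, hc.r1, hc.r4, h14, mask_zero]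
    exact ⟨by omega, hc.update (by norm_num), trivial, hM, trivial⟩
  · rintro i hi s ⟨hc, h16, hM, h14⟩
    refine ⟨?_, (wp_maskBody hw hE hi hc h16 hM h14 hf.num hr.le).runs.mono (by decide)
      fun _ h => h⟩
    rw [Test.Holds, h16, hc.r9]
    omega
  · rintro s ⟨hc, h16, -⟩
    rw [Test.Holds, h16, hc.r9]
    omega
  · obtain ⟨hc, h16, hM, h14⟩ := h₂
    simp only [Prog.wp, State.setReg, update_self, update_of_ne, ne_eq, Nat.reduceEqDiff,
      not_false_eq_true, hc.r1, hc.r4, h14, visitedBy_zero]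
    exact ⟨by omega, hc.update (by norm_num), trivial, f, r, _, hM, rfl, .zero hf.num⟩
  · rintro i hi s ⟨hc, h16, g, r', cnt, hM, h14, hs⟩
    refine ⟨?_, (wp_selectBody hw hi hc h16 hM h14 (fun u => (mask_lt hf.num u).trans_le
      (Nat.pow_le_pow_right (by norm_num) hr.le)) hs).runs.mono (by decide) fun _ h => h⟩
    rw [Test.Holds, h16, hc.r9]
    omega
  · rintro s ⟨hc, h16, -⟩
    rw [Test.Holds, h16, hc.r9]
    omega
  · obtain ⟨hc, h16, g, r', cnt, hM, h14, hs⟩ := h₄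
    refine (runs_trivialOut hc.r0 hc.r1 hc.r4).mono (by omega) fun s hs' => Or.inl ?_
    refine ⟨hs'.1, hs'.2.1, hs'.2.2, ?_⟩
    by_contra hno
    have := hs.card_le hE hf hno
    rw [Test.Holds, hc.r7, h14] at ht
    omega
  · obtain ⟨hc, h16, g, r', cnt, hM, h14, hs⟩ := h₄
    refine (runs_writeOut hw hc hM h14 hs.num).mono le_rfl fun s hs' => Or.inr ?_
    rw [Test.Holds, hc.r7, h14, not_lt] at ht
    exact ⟨f, r, g, r', cnt, hf, hr, hs, ht, hs'⟩
  · simp only [Prog.cost]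
    omega

theorem runs_kernelize (hw : Wide n m l B) (hE : EdgeSeq G m a b) {s : State}
    (h0 : s.reg 0 = 0) (h1 : s.reg 1 = 1) (h2 : s.reg 2 = n) (h3 : s.reg 3 = m)
    (h4 : s.reg 4 = 2) (h6 : s.reg 6 = l) (h7 : s.reg 7 = 4 * l * 2 ^ l)
    (hM : Mem m a b 0 (fun _ => 0) (fun _ => 0) (fun _ => 0) (fun _ => 0) s.mem) :
    Runs B kernelize s (164 * m + 80) (fun s => Outcome G l m a b s.mem) := by
  have hB := hw.lt
  refine Runs.mono (Runs.seq (Prog.wp.runs (Q := fun s => Ctx n m l s.reg ∧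
      s.reg 16 = 3 + 2 * 0 ∧ ∃ f r, Mem m a b 0 (weight f) (fun _ => 0) f (fun _ => 0) s.mem ∧
      s.reg 14 = r ∧ s.reg 15 = 2 ^ r ∧ MatchInv G l a b 0 f r) ?_) fun s₁ h₁ =>
    Runs.seq (Runs.loop (fun i s => Ctx n m l s.reg ∧
      s.reg 16 = 3 + 2 * i ∧ ∃ f r, Mem m a b 0 (weight f) (fun _ => 0) f (fun _ => 0) s.mem ∧
      s.reg 14 = r ∧ s.reg 15 = 2 ^ r ∧ MatchInv G l a b i f r) m 40 h₁ ?_ ?_) fun s₂ h₂ =>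
    Runs.ite (T := 123 * m + 50) (fun ht => ?_) (fun ht => ?_)) ?_ fun _ h => h
  · simp only [seqs, Prog.wp, State.setReg, update_self, update_of_ne, ne_eq, Nat.reduceEqDiff,
      not_false_eq_true, OfNat.one_ne_ofNat, h1, h2, h3, h4, h6]
    refine ⟨by omega, by omega, by omega, by omega, by omega, by omega, by omega, by omega,
      by omega, by omega, ?_, trivial, fun _ => 0, 0, ?_, rfl, rfl, .zero⟩
    · constructor <;> simp [*] <;> omega
    · rwa [weight_zero]
  · rintro i hi s ⟨hc, h16, f, r, hM, h14, h15, hf⟩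
    refine ⟨?_, (wp_matchBody hw hE hi hc h16 hM h14 h15 hf).runs.mono (by decide) fun _ h => h⟩
    rw [Test.Holds, h16, hc.r9]
    omega
  · rintro s ⟨hc, h16, -⟩
    rw [Test.Holds, h16, hc.r9]
    omega
  · obtain ⟨hc, h16, f, r, hM, h14, h15, hf⟩ := h₂
    rw [Test.Holds, hc.r13, h14] at ht
    exact runs_classify hw hE hc hM h14 hf ht
  · obtain ⟨hc, h16, f, r, hM, h14, h15, hf⟩ := h₂
    rw [Test.Holds, hc.r13, h14] at ht
    exact (runs_trivialOut hc.r0 hc.r1 hc.r4).mono (by omega) fun s hs' =>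
      Or.inl ⟨hs'.1, hs'.2.1, hs'.2.2, hf.hasStrong ht⟩
  · simp only [seqs, Prog.cost]
    omega

/-- The program on an instance that does not ask for strong edges. -/
theorem runs_program_of_le {s : State} {k : ℕ} (h0 : s.mem 0 = n)
    (h1 : s.mem 1 = m) (h2 : s.mem 2 = k) (hk : m ≤ k) (hB : n + m + k + 2 < B) :
    Runs B program s 100 (fun s => s.mem 0 = 0 ∧ s.mem 1 = 0 ∧ s.mem 2 = 0) := by
  refine Runs.mono (Runs.seq (Prog.wp.runs (Q := fun s' => s'.reg 0 = 0 ∧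
      s'.reg 1 = 1 ∧ s'.reg 4 = 2 ∧ s'.reg 6 = 0) ?_)
    fun s₁ h₁ => Runs.ite (T := 10) (fun ht => ?_) (fun ht => ?_)) ?_ fun _ h => h
  · simp only [prologue, seqs, Prog.wp, State.setReg, update_self, update_of_ne, ne_eq,
      Nat.reduceEqDiff, not_false_eq_true, OfNat.zero_ne_ofNat, OfNat.one_ne_ofNat,
      zero_ne_one, Nat.reduceAdd, h0, h1, h2]
    simp
    omega
  · rw [Test.Holds, h₁.1, h₁.2.2.2] at ht
    omega
  · exact (runs_trivialOut h₁.1 h₁.2.1 h₁.2.2.1).mono (by norm_num) fun _ h => h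
  · simp only [prologue, seqs, Prog.cost]
    omega

/-- The program on an instance, given that the words are wide enough. In the last case the input
is returned as it is. -/
theorem runs_program (hE : EdgeSeq G m a b) {s : State} {k : ℕ} (h0 : s.mem 0 = n)
    (h1 : s.mem 1 = m) (h2 : s.mem 2 = k) (hk : k < m) (hl : l = m - k)
    (hM : Mem m a b 0 (fun _ => 0) (fun _ => 0) (fun _ => 0) (fun _ => 0) s.mem)
    (hB : 20 * (n + m + k + 2) ^ 2 < B) :
    Runs B program s (250 * (m + 1))
      (fun s' => Outcome G l m a b s'.mem ∨ s'.mem = s.mem ∧ n ≤ 4 * l * 2 ^ l) := by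
  have hB' : 20 * (n + m + k + 2) < B :=
    (Nat.mul_le_mul_left 20 (Nat.le_self_pow two_ne_zero _)).trans_lt hB
  refine Runs.mono (Runs.seq (Prog.wp.runs (Q := fun s' => s'.mem = s.mem ∧ s'.reg 0 = 0 ∧
      s'.reg 1 = 1 ∧ s'.reg 2 = n ∧ s'.reg 3 = m ∧ s'.reg 4 = 2 ∧ s'.reg 6 = l) ?_)
    fun s₁ h₁ => Runs.ite (T := 180 * m + 150) (fun ht => Runs.mono (
      Runs.seq (Prog.wp.runs (Q := fun s' => s'.mem = s.mem ∧ s'.reg 0 = 0 ∧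
        s'.reg 1 = 1 ∧ s'.reg 2 = n ∧ s'.reg 3 = m ∧ s'.reg 4 = 2 ∧ s'.reg 6 = l ∧ s'.reg 8 = 0 ∧
        (s'.reg 7 = 4 * l * 2 ^ 0 ∨ n < s'.reg 7 ∧ s'.reg 7 ≤ 4 * l * 2 ^ 0) ∧
        s'.reg 7 ≤ 4 * l + 2 * n) ?_)
      fun s₂ h₂ => Runs.seq (Runs.loop (fun i s' => s'.mem = s.mem ∧ s'.reg 0 = 0 ∧
        s'.reg 1 = 1 ∧ s'.reg 2 = n ∧ s'.reg 3 = m ∧ s'.reg 4 = 2 ∧ s'.reg 6 = l ∧ s'.reg 8 = i ∧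
        (s'.reg 7 = 4 * l * 2 ^ i ∨ n < s'.reg 7 ∧ s'.reg 7 ≤ 4 * l * 2 ^ i) ∧
        s'.reg 7 ≤ 4 * l + 2 * n) l 10 h₂ ?_ ?_)
      fun s₃ h₃ => Runs.ite (T := 164 * m + 80) (fun ht' => ?_) (fun ht' => ?_))
      ?_ fun _ h => h) (fun ht => ?_)) ?_ fun _ h => h
  · have hm : m - k < B := by omega
    simp only [prologue, seqs, Prog.wp, State.setReg, update_self, update_of_ne, ne_eq,
      Nat.reduceEqDiff, not_false_eq_true, OfNat.zero_ne_ofNat, OfNat.one_ne_ofNat,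
      zero_ne_one, Nat.reduceAdd, h0, h1, h2,
      hl]
    simp
    omega
  · obtain ⟨hm, h0, h1, h2, h3, h4, h6⟩ := h₁
    simp only [seqs, Prog.wp, State.setReg, update_self, update_of_ne, ne_eq,
      Nat.reduceEqDiff, not_false_eq_true, OfNat.zero_ne_ofNat, OfNat.one_ne_ofNat, h0, h1, h2, h3,
      h4, h6, hm]
    refine ⟨by omega, by omega, by omega, trivial, trivial, trivial, trivial, trivial, trivial,
      trivial, trivial, Or.inl (by ring), by omega⟩
  · rintro i hi s' ⟨hm, h0, h1, h2, h3, h4, h6, h8, h7, h7'⟩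
    refine ⟨by rw [Test.Holds, h8, h6]; exact hi, Runs.mono (Prog.wp.runs ?_) (by decide)
      fun _ h => h⟩
    simp only [doubleBody, seqs, Prog.wp, State.setReg, Test.Holds, update_self, update_of_ne,
      ne_eq, Nat.reduceEqDiff, not_false_eq_true, OfNat.zero_ne_ofNat, OfNat.one_ne_ofNat, h0, h1,
      h2, h3, h4, h6, h8, hm, pow_succ]
    refine ⟨fun h => ⟨by omega, trivial, trivial, trivial, trivial, trivial, trivial, trivial,
      trivial, Or.inr ⟨h, ?_⟩, h7'⟩, fun h => ⟨by omega, by omega, trivial, trivial, trivial,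
      trivial, trivial, trivial, trivial, trivial, Or.inl ?_, by omega⟩⟩
    · rw [← mul_assoc]
      omega
    · rw [← mul_assoc]
      omega
  · rintro s' ⟨hm, h0, h1, h2, h3, h4, h6, h8, h7, h7'⟩
    rw [Test.Holds, h8, h6]
    omega
  · obtain ⟨hm, h0, h1, h2, h3, h4, h6, h8, h7, h7'⟩ := h₃
    rw [Test.Holds, h2] at ht'
    exact Runs.mono (Prog.wp.runs (P := .skip) (Q := fun s' => s'.mem = s.mem) hm)
      (by simp only [Prog.cost]; omega) fun s' hs' => Or.inr ⟨hs', by omega⟩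
  · obtain ⟨hm, h0, h1, h2, h3, h4, h6, h8, h7, h7'⟩ := h₃
    rw [Test.Holds, h2] at ht'
    have h7e : s₃.reg 7 = 4 * l * 2 ^ l := by omega
    -- Here `2 ^ l ≤ 4 * l * 2 ^ l ≤ n`, so masks, which are below `2 ^ (2 * l)`, are polynomially
    -- bounded and can serve as addresses.
    have hpow : 2 ^ (2 * l) ≤ n ^ 2 := by
      rw [mul_comm, pow_mul]
      refine Nat.pow_le_pow_left ?_ 2
      have : 1 * 2 ^ l ≤ 4 * l * 2 ^ l := Nat.mul_le_mul_right _ (by omega)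
      omega
    have hw : Wide n m l B := by
      have h9 : n ^ 2 ≤ (n + m + k + 2) ^ 2 := Nat.pow_le_pow_left (by omega) 2
      have h10 : n + m + k + 2 ≤ (n + m + k + 2) ^ 2 := Nat.le_self_pow two_ne_zero _
      refine ⟨?_⟩
      generalize (n + m + k + 2) ^ 2 = Q at *
      generalize n ^ 2 = R at *
      generalize 2 ^ (2 * l) = S at *
      clear h7 h7' h7e
      omega
    exact (runs_kernelize hw hE h0 h1 h2 h3 h4 h6 h7e (hm ▸ hM)).mono le_rfl fun _ => Or.inl
  · simp only [seqs, Prog.cost]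
    omega
  · rw [Test.Holds, h₁.2.1, h₁.2.2.2.2.2.2] at ht
    omega
  · simp only [prologue, seqs, Prog.cost]
    omega

end

end STC

/-! ### Encodings and correctness of the output instance -/

namespace STC

open RAM Function

theorem m_le_sq (I : STCInstance) : I.m ≤ I.n ^ 2 := by
  have h1 : I.m ≤ Fintype.card (Sym2 (Fin I.n)) := by
    rw [STCInstance.m, ← Nat.card_eq_fintype_card, ← Set.ncard_univ]
    exact Set.ncard_le_ncard (Set.subset_univ _)
  have h2 : Fintype.card (Sym2 (Fin I.n)) ≤ Fintype.card (Fin I.n × Fin I.n) :=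
    Fintype.card_le_of_surjective (fun p => s(p.1, p.2)) fun e => by
      induction e with
      | h a b => exact ⟨(a, b), rfl⟩
  rw [Fintype.card_prod, Fintype.card_fin, ← sq] at h2
  exact h1.trans h2

theorem length_eq_m {I : STCInstance} {es : List (Fin I.n × Fin I.n)} (h : I.IsEdgeList es) :
    es.length = I.m := by
  classical
  have : I.G.edgeSet = ((es.map fun e => s(e.1, e.2)).toFinset : Set (Sym2 (Fin I.n))) := by
    ext e
    rw [Finset.mem_coe, List.mem_toFinset, h.2]
  rw [STCInstance.m, this, Set.ncard_coe_finset, List.toFinset_card_of_nodup h.1, List.length_map]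

theorem edgeSeq_of_isEdgeList {I : STCInstance} {es : List (Fin I.n × Fin I.n)}
    (h : I.IsEdgeList es) (d : Fin I.n × Fin I.n) :
    EdgeSeq I.G es.length (fun j => (es.getD j d).1) (fun j => (es.getD j d).2) := by
  refine ⟨fun u v => ?_, fun i hi j hj hij => ?_⟩
  · rw [← SimpleGraph.mem_edgeSet, ← h.2, List.mem_iff_getElem]
    constructor
    · rintro ⟨j, hj, hje⟩
      rw [List.length_map] at hj
      refine ⟨j, hj, ?_⟩
      rw [List.getElem_map] at hje
      rwa [List.getD_eq_getElem _ _ hj]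
    · rintro ⟨j, hj, hje⟩
      refine ⟨j, by rwa [List.length_map], ?_⟩
      rw [List.getElem_map]
      rwa [List.getD_eq_getElem _ _ hj] at hje
  · rw [List.getD_eq_getElem _ _ hi, List.getD_eq_getElem _ _ hj] at hij
    refine (h.1.getElem_inj_iff (hi := by rwa [List.length_map])
      (hj := by rwa [List.length_map])).1 ?_
    rwa [List.getElem_map, List.getElem_map]

theorem getD_flat (L : List (ℕ × ℕ)) (j : ℕ) :
    (flat L).getD (2 * j) 0 = (L.getD j (0, 0)).1 ∧
      (flat L).getD (2 * j + 1) 0 = (L.getD j (0, 0)).2 := by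
  induction L generalizing j with
  | nil => simp [flat]
  | cons e L ih =>
    have : flat (e :: L) = e.1 :: e.2 :: flat L := rfl
    rw [this]
    cases j with
    | zero => simp
    | succ j => simpa [Nat.mul_succ] using ih j

/-- The endpoints of the edges in a list, as numbers. -/
def toNat {n : ℕ} (es : List (Fin n × Fin n)) : List (ℕ × ℕ) :=
  es.map fun e => ((e.1 : ℕ), (e.2 : ℕ))

theorem flat_toNat {n : ℕ} (es : List (Fin n × Fin n)) :
    flat (toNat es) = es.flatMap fun e => [(e.1 : ℕ), (e.2 : ℕ)] := by
  rw [flat, toNat, List.flatMap_map]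

/-- Memory behind the input is zero, so none of the arrays has to be cleared; their lengths do not
enter the running time. -/
theorem mem_init {n : ℕ} (es : List (Fin n × Fin n)) (k : ℕ) (d : Fin n × Fin n) :
    Mem es.length (fun j => (es.getD j d).1) (fun j => (es.getD j d).2) 0 (fun _ => 0) (fun _ => 0)
      (fun _ => 0) (fun _ => 0) (RAM.init (n :: es.length :: k :: flat (toNat es))).mem := by
  have hμ : ∀ t, (RAM.init (n :: es.length :: k :: flat (toNat es))).mem (3 + t) =
      (flat (toNat es)).getD t 0 := by
    intro t
    rw [add_comm]
    simp [RAM.init]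
  have hlen : (flat (toNat es)).length = 2 * es.length := by simp [length_flat, toNat]
  have hfar : ∀ p, 3 + 2 * es.length ≤ p →
      (RAM.init (n :: es.length :: k :: flat (toNat es))).mem p = 0 := by
    intro p hp
    obtain ⟨t, rfl⟩ : ∃ t, p = 3 + t := ⟨p - 3, by omega⟩
    rw [hμ, List.getD_eq_default _ _ (by omega)]
  refine ⟨fun j _ hj => ?_, fun j _ hj => ?_, fun u => hfar _ (by omega), fun u => hfar _ (by omega),
    fun u => hfar _ (by omega), fun u => hfar _ (by omega)⟩
  · rw [hμ, (getD_flat _ _).1, List.getD_eq_getElem _ _ (by simpa [toNat]),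
      List.getD_eq_getElem _ _ hj]
    simp [toNat]
  · rw [add_assoc, hμ, (getD_flat _ _).2, List.getD_eq_getElem _ _ (by simpa [toNat]),
      List.getD_eq_getElem _ _ hj]
    simp [toNat]

theorem outputs_cons {s : State} {n m k : ℕ} {L : List (ℕ × ℕ)} (h0 : s.mem 0 = n)
    (h1 : s.mem 1 = m) (h2 : s.mem 2 = k) (hW : Written L s.mem) :
    Outputs s (n :: m :: k :: flat L) := by
  intro i hi
  match i with
  | 0 => simpa
  | 1 => simpa
  | 2 => simpa
  | t + 3 =>
    rw [add_comm, hW t (by simpa [length_flat] using hi), add_comm]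
    simp

/-- The edges between selected vertices form the edge list of the induced subgraph. -/
theorem exists_edgeList_comap {n m r : ℕ} {G : SimpleGraph (Fin n)} {a b : ℕ → Fin n}
    (hE : EdgeSeq G m a b) {g : Fin n → ℕ} (hg : Numbering g r) (hr : 0 < r) {φ : Fin r ↪ Fin n}
    (hφ : ∀ t, g (φ t) = t + 1) (hφ' : ∀ v, v ∈ Set.range φ ↔ g v ≠ 0) (k : ℕ) :
    ∃ es : List (Fin r × Fin r), STCInstance.IsEdgeList ⟨r, G.comap φ, k⟩ es ∧
      toNat es = outEdges g a b m := by
  -- Unselected vertices get the junk value `0`, which lies in `Fin r` because `0 < r`.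
  set ψ : Fin n → Fin r := fun v => ⟨g v - 1, by have := hg.le v; omega⟩ with hψ
  have hψφ : ∀ t, ψ (φ t) = t := fun t => Fin.ext (by simp [hψ, hφ])
  have hφψ : ∀ v, g v ≠ 0 → φ (ψ v) = v := by
    intro v hv
    obtain ⟨t, rfl⟩ := (hφ' v).2 hv
    rw [hψφ]
  have hmem : ∀ j, j ∈ keptEdges g a b m ↔ j < m ∧ g (a j) ≠ 0 ∧ g (b j) ≠ 0 := by
    intro j
    simp [keptEdges]
  refine ⟨(keptEdges g a b m).map fun j => (ψ (a j), ψ (b j)), ⟨?_, ?_⟩, ?_⟩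
  · rw [List.map_map]
    refine List.Nodup.map_on (fun i hi j hj hij => ?_) (List.nodup_range.filter _)
    rw [hmem] at hi hj
    refine hE.inj i hi.1 j hj.1 ?_
    have := congrArg (Sym2.map φ) hij
    simpa [Sym2.map_mk, hφψ _ hi.2.1, hφψ _ hi.2.2, hφψ _ hj.2.1, hφψ _ hj.2.2] using this
  · intro e
    rw [List.map_map, List.mem_map]
    induction e with
    | h u v =>
      rw [SimpleGraph.mem_edgeSet, SimpleGraph.comap_adj, hE.adj_iff]
      constructor
      · rintro ⟨j, hj, hje⟩
        rw [hmem] at hj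
        refine ⟨j, hj.1, ?_⟩
        have := congrArg (Sym2.map φ) hje
        simpa [Sym2.map_mk, hφψ _ hj.2.1, hφψ _ hj.2.2] using this
      · rintro ⟨j, hj, hje⟩
        have hu : g (φ u) ≠ 0 := by simp [hφ]
        have hv : g (φ v) ≠ 0 := by simp [hφ]
        refine ⟨j, (hmem j).2 ⟨hj, ?_⟩, ?_⟩
        · rcases Sym2.eq_iff.1 hje with h | h <;> simp [h.1, h.2, hφ]
        · have := congrArg (Sym2.map ψ) hje
          simpa [Sym2.map_mk, hψφ] using this
  · simp [toNat, outEdges, hψ]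

/-- The memory holds a kernel of the instance. -/
def HoldsKernel (I : STCInstance) (s : State) : Prop :=
  ∃ (I' : STCInstance) (w' : List ℕ), I'.Encodes w' ∧ Outputs s w' ∧ (I.IsYes ↔ I'.IsYes) ∧
    I'.ell ≤ I.ell ∧ I'.size ≤ 4 * I.ell * 2 ^ I.ell + 2 * (4 * I.ell * 2 ^ I.ell) ^ 2 ∧
    I'.n ≤ 4 * I.ell * 2 ^ I.ell

theorem size_le {I : STCInstance} {T : ℕ} (hn : I.n ≤ T) (hk : I.k ≤ I.m) :
    I.size ≤ T + 2 * T ^ 2 := by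
  have h1 := m_le_sq I
  have h2 : I.n ^ 2 ≤ T ^ 2 := Nat.pow_le_pow_left hn 2
  rw [STCInstance.size]
  omega

theorem holdsKernel_of_isYes {I : STCInstance} {s : State} (hI : I.IsYes) (h0 : s.mem 0 = 0)
    (h1 : s.mem 1 = 0) (h2 : s.mem 2 = 0) : HoldsKernel I s := by
  have hlist : STCInstance.IsEdgeList ⟨0, ⊥, 0⟩ [] := ⟨by simp, by simp⟩
  have hm := length_eq_m hlist
  have hell : STCInstance.ell ⟨0, ⊥, 0⟩ = 0 := by
    rw [STCInstance.ell, ← hm]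
    rfl
  refine ⟨⟨0, ⊥, 0⟩, 0 :: 0 :: 0 :: flat [], ⟨[], hlist, rfl⟩,
    outputs_cons h0 h1 h2 fun t ht => by simp at ht, iff_of_true hI ?_, by omega,
    size_le (Nat.zero_le _) (Nat.zero_le _), Nat.zero_le _⟩
  rw [isYes_iff_hasStrong, hell]
  exact ⟨∅, by simp, rfl, by simp [IsStrongSet]⟩

theorem Outcome.holdsKernel {I : STCInstance} {a b : ℕ → Fin I.n} {s : State}
    (hE : EdgeSeq I.G I.m a b) (hl : 0 < I.ell)
    (h : Outcome I.G I.ell I.m a b s.mem) : HoldsKernel I s := by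
  rcases h with ⟨h0, h1, h2, hs⟩ | ⟨f, r, g, r', cnt, hf, hr, hs, hr', h0, h1, h2, hW⟩
  · exact holdsKernel_of_isYes ((isYes_iff_hasStrong I).2 hs) h0 h1 h2
  -- As `r < 2 * l`, an end of the first edge is matched, hence selected.
  have hpos : 0 < r' := by
    have hm : 0 < I.m := by
      rw [STCInstance.ell] at hl
      omega
    have hne : ∃ u, f u ≠ 0 := by
      rcases hf.cover 0 hm with h | h | h
      exacts [⟨_, h⟩, ⟨_, h⟩, by omega]
    obtain ⟨u, hu⟩ := hne
    have h3 := hs.num.le u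
    have h4 := hs.extend u hu
    omega
  obtain ⟨φ, hφ, hφ'⟩ := hs.num.exists_embedding
  obtain ⟨es, hes, hout⟩ :=
    exists_edgeList_comap hE hs.num hpos hφ hφ' ((outEdges g a b I.m).length - I.ell)
  have hlen : (outEdges g a b I.m).length = es.length := by
    rw [← hout, toNat, List.length_map]
  have hm' := length_eq_m hes
  have htw : ∀ v ∉ Set.range φ, ∀ x, I.G.Adj v x → ∃ D : Finset (Fin I.n), 2 * I.ell ≤ D.card ∧
      ∀ w ∈ D, w ∈ Set.range φ ∧ ∀ y, I.G.Adj w y ↔ I.G.Adj v y := by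
    intro v hv x hvx
    rw [hφ', not_not] at hv
    obtain ⟨D, hD, hDw⟩ := hs.exists_twins hE hf hr hv hvx
    exact ⟨D, hD, fun w hw => ⟨(hφ' w).2 (hDw w hw).1, (hDw w hw).2⟩⟩
  have hlm : I.ell ≤ es.length :=
    hm' ▸ le_ncard_edgeSet_comap φ htw (Nat.sub_le I.m I.k)
  have hell : STCInstance.ell ⟨r', I.G.comap φ, (outEdges g a b I.m).length - I.ell⟩ = I.ell := by
    rw [STCInstance.ell, ← hm', hlen]
    exact Nat.sub_sub_self hlm
  refine ⟨⟨r', I.G.comap φ, (outEdges g a b I.m).length - I.ell⟩,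
    r' :: es.length :: ((outEdges g a b I.m).length - I.ell) :: flat (toNat es),
    ⟨es, hes, by rw [flat_toNat]⟩, ?_, ?_, hell.le, size_le hr' ?_, hr'⟩
  · exact outputs_cons h0 (h1.trans hlen) h2 (hout ▸ hW)
  · rw [isYes_iff_hasStrong, isYes_iff_hasStrong, hell]
    exact hasStrong_comap_iff φ htw
  · rw [← hm', hlen]
    exact Nat.sub_le _ _

theorem runs_program_holdsKernel (I : STCInstance) {w : List ℕ} (hw : I.Encodes w) :
    Runs ((I.size + 2) ^ 8) program (RAM.init w) (250 * (I.m + 1)) (HoldsKernel I) := by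
  obtain ⟨es, hes, rfl⟩ := hw
  have hm := length_eq_m hes
  have hB : 20 * (I.n + I.m + I.k + 2) ^ 2 < (I.size + 2) ^ 8 := by
    have h2 : 2 ≤ I.size + 2 := by omega
    -- The exponent is 8 = 6 + 2: the factor `20` is absorbed by `2 ^ 6`.
    have h6 : 2 ^ 6 ≤ (I.size + 2) ^ 6 := Nat.pow_le_pow_left h2 6
    have hp : 0 < (I.size + 2) ^ 2 := by positivity
    calc 20 * (I.size + 2) ^ 2 < 2 ^ 6 * (I.size + 2) ^ 2 := by omega
      _ ≤ (I.size + 2) ^ 6 * (I.size + 2) ^ 2 := Nat.mul_le_mul_right _ h6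
      _ = (I.size + 2) ^ 8 := by ring
  rw [← flat_toNat]
  rcases Nat.lt_or_ge I.k I.m with hk | hk
  · have hne : es ≠ [] := by
      rintro rfl
      simp at hm
      omega
    -- `d` serves only as the default value of `getD`.
    obtain ⟨d, -⟩ := List.exists_mem_of_ne_nil es hne
    have hE := edgeSeq_of_isEdgeList hes d
    have hM := mem_init es I.k d
    set s := RAM.init (I.n :: es.length :: I.k :: flat (toNat es)) with hs
    rw [hm] at hE hM
    refine (runs_program hE (s := s) rfl hm rfl hk rfl hM hB).mono le_rfl ?_
    rintro s' (h | ⟨h, hn⟩)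
    · exact h.holdsKernel hE (Nat.sub_pos_of_lt hk)
    · refine ⟨I, _, ⟨es, hes, congrArg _ (congrArg _ (congrArg _ (flat_toNat es)))⟩, ?_, Iff.rfl,
        le_rfl, size_le hn hk.le, hn⟩
      intro i _
      rw [h]
      rfl
  · refine (runs_program_of_le (n := I.n) (m := es.length) (k := I.k)
      rfl rfl rfl (hm.trans_le hk) ?_).mono (by omega) fun s' hs' =>
        holdsKernel_of_isYes ?_ hs'.1 hs'.2.1 hs'.2.2
    · rw [hm]
      have : I.n + I.m + I.k + 2 ≤ (I.n + I.m + I.k + 2) ^ 2 := Nat.le_self_pow two_ne_zero _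
      omega
    · have h0 : I.ell = 0 := Nat.sub_eq_zero_of_le hk
      rw [isYes_iff_hasStrong, h0]
      exact ⟨∅, by simp, rfl, by simp [IsStrongSet]⟩

/-- The program is linear in `m`; the factor `√n` is at least `1` unless `n = 0`, when there are no
edges. -/
theorem m_le_sqrt_mul (I : STCInstance) : (I.m : ℝ) ≤ Real.sqrt I.n * I.m := by
  rcases Nat.eq_zero_or_pos I.n with h | h
  · have := m_le_sq I
    have h0 : I.m = 0 := by
      rw [h] at this
      simpa using this
    simp [h0]
  · have : (1 : ℝ) ≤ Real.sqrt I.n := Real.one_le_sqrt.2 (by exact_mod_cast h)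
    nlinarith [(Nat.cast_nonneg I.m : (0 : ℝ) ≤ I.m)]

end STC

theorem mainTheorem8 :
    ∃ (P : RAM.Prog) (C : ℕ),
      IsSTCKernelization P (fun l => C * (l * 2 ^ l))
        (fun I => C * (Real.sqrt I.n * I.m + 1)) := by
  refine ⟨STC.program, 250, 8, fun l => 4 * l * 2 ^ l + 2 * (4 * l * 2 ^ l) ^ 2,
    fun I w hw => ?_⟩
  obtain ⟨t, s, hexec, ht, I', w', h1, h2, h3, h4, h5, h6⟩ :=
    STC.runs_program_holdsKernel I hw
  refine ⟨t, s, I', w', hexec, ?_, h1, h2, h3, h4, h5, h6.trans ?_⟩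
  · have hm := STC.m_le_sqrt_mul I
    have ht' : (t : ℝ) ≤ 250 * (I.m + 1) := by exact_mod_cast ht
    push_cast
    linarith
  · rw [mul_assoc]
    exact Nat.mul_le_mul_right _ (by norm_num)
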